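/- Let $d\in\mathbb N$, $\gamma\le 0$, and set, for $z\in\mathbb R^d$, $$A(z)=|z|^\gamma\,(|z|^2 I_d-z\otimes z),\qquad b(z)=\nabla\cdot A(z)=-(d-1)\,|z|^\gamma z$$ (so $b(z)=-2z|z|^\gamma$ when $d=3$). Write $\langle v\rangle=(1+|v|^2)^{1/2}$, $|x|_M^2=x\cdot Mx$, $\|M\|$ for the operator norm of a matrix $M$, $(A*h)(v)=\int A(v-w)h(w)\,dw$, $(b*h)(v)=\int b(v-w)h(w)\,dw$, $$U[f](v)=-\int_{\mathbb R^d}A(v-w)\big(\nabla\log f(v)-\nabla\log f(w)\big)f(w)\,dw,\qquad \mathrm{KL}(f\|g)=\int_{\mathbb R^d} f\log\frac fg\,dv.$$ Let $f,g$ be differentiable probability densities on $\mathbb R^d$ with finite energy $\frac12\int|v|^2f\,dv$ and finite entropy $\int f\log f\,dv$ (and likewise for $g$). They may vanish: integrands carrying a factor $f$ are read as $0$ where $f=0$, also inside $U[f]$, and likewise for $g$; but $g>0$ is required almost everywhere on $\{f>0\}$. No equation is assumed for $f$ or $g$. (1) There is a constant $C>0$, depending only on $d$, $\gamma$ and on upper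 bounds for the energy and the entropy of $g$, such that $$\int f\,(U[f]-U[g])\cdot\nabla\log\frac fg\;\le\;-\frac12\int f\,\Big|\nabla\log\frac fg\Big|^2_{A*g}+C\int f\langle v\rangle^{-\gamma}\|A*(f-g)\|^2|\nabla\log f|^2+C\int f\langle v\rangle^{-\gamma}|b*(f-g)|^2$$ whenever both sides are defined and finite, i.e. the integrals defining $U[f](v)$, $U[g](v)$, $(A*g)(v)$, $(A*(f-g))(v)$, $(b*(f-g))(v)$ converge absolutely for almost every $v$ with $f(v)>0$, and the four displayed integrals converge absolutely. (2) Let $d=3$, $\gamma=-3$. There is a constant $C>0$, depending only on upper bounds for the energy and the entropy of $g$, such that $$\int f\,(U[f]-U[g])\cdot\nabla\log\frac fg\;\le\;-\frac12\int f\,\Big|\nabla\log\frac fg\Big|^2_{A*g}+C\,\mathrm{KL}(f\|g)\Big(\big(\|f\|_\infty+\|g\|_\infty\big)\big(\|f\langle v\rangle^3|\nabla\log f|^2\|_1+\|f\langle v\rangle^3\|_2\big)+\|f\langle v\rangle^3\|_1\Big)$$ whenever both sides are defined and finite, i.e. the integrals defining $U[f](v)$ and $U[g](v)$ converge absolutely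 for almost every $v$ with $f(v)>0$, the two displayed integrals and the integral defining $\mathrm{KL}(f\|g)$ converge absolutely, and all the norms on the right are finite. -/

import Mathlib

open MeasureTheory
open scoped Convolution ENNReal

noncomputable section

namespace Landau

/-- Velocity space `ℝ^d` with its Euclidean norm. -/
abbrev Vel (d : ℕ) : Type := EuclideanSpace ℝ (Fin d)

variable {d : ℕ}

/-- The Landau kernel `A(z) = |z|^γ (|z|² I_d - z ⊗ z)`, as an operator on `ℝ^d`
(so that `‖·‖` is the operator norm of the matrix). -/
def A (γ : ℝ) (z : Vel d) : Vel d →L[ℝ] Vel d :=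
  (‖z‖ ^ γ) • ((‖z‖ ^ 2) • ContinuousLinearMap.id ℝ (Vel d) - (innerSL ℝ z).smulRight z)

/-- The divergence `b = ∇ · A`, that is `b(z) = -(d - 1) |z|^γ z`; this is `-2 z |z|^γ` for `d = 3`.
See `divergence_A`. -/
def b (γ : ℝ) (z : Vel d) : Vel d :=
  (-((d : ℝ) - 1) * ‖z‖ ^ γ) • z

/-- The Japanese bracket `⟨v⟩ = (1 + |v|²)^{1/2}`. -/
def jb (v : Vel d) : ℝ := Real.sqrt (1 + ‖v‖ ^ 2)

/-- `∇ log f`. -/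
def score (f : Vel d → ℝ) (v : Vel d) : Vel d :=
  gradient (fun w => Real.log (f w)) v

/-- `∇ log (f / g)`. -/
def relScore (f g : Vel d → ℝ) (v : Vel d) : Vel d :=
  gradient (fun w => Real.log (f w / g w)) v

/-- The integrand (in `w`) of the velocity field `U[f](v)`. -/
def fieldIntegrand (γ : ℝ) (f : Vel d → ℝ) (v w : Vel d) : Vel d :=
  f w • A γ (v - w) (score f v - score f w)

/-- The velocity field
`U[f](v) = - ∫ A(v - w) (∇ log f(v) - ∇ log f(w)) f(w) dw`. -/
def U (γ : ℝ) (f : Vel d → ℝ) (v : Vel d) : Vel d :=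
  -∫ w, fieldIntegrand γ f v w

/-- The convolution `(A ∗ h)(v) = ∫ h(w) A(v - w) dw`. -/
def convA (γ : ℝ) (h : Vel d → ℝ) : Vel d → (Vel d →L[ℝ] Vel d) :=
  h ⋆[ContinuousLinearMap.lsmul ℝ ℝ, volume] A γ

/-- The integral defining `(A ∗ h)(v)` converges absolutely. -/
def ConvAExistsAt (γ : ℝ) (h : Vel d → ℝ) (v : Vel d) : Prop :=
  ConvolutionExistsAt h (A γ) v (ContinuousLinearMap.lsmul ℝ ℝ) volume

/-- The convolution `(b ∗ h)(v) = ∫ h(w) b(v - w) dw`. -/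
def convB (γ : ℝ) (h : Vel d → ℝ) : Vel d → Vel d :=
  h ⋆[ContinuousLinearMap.lsmul ℝ ℝ, volume] b γ

/-- The integral defining `(b ∗ h)(v)` converges absolutely. -/
def ConvBExistsAt (γ : ℝ) (h : Vel d → ℝ) (v : Vel d) : Prop :=
  ConvolutionExistsAt h (b γ) v (ContinuousLinearMap.lsmul ℝ ℝ) volume

/-- `|x|²_M = x · M x`. -/
def quadNormSq (M : Vel d →L[ℝ] Vel d) (x : Vel d) : ℝ := inner ℝ x (M x)

/-- The energy `½ ∫ |v|² f dv`. -/
def energy (f : Vel d → ℝ) : ℝ := 1 / 2 * ∫ v, ‖v‖ ^ 2 * f v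

/-- The entropy `∫ f log f dv`. -/
def entropy (f : Vel d → ℝ) : ℝ := ∫ v, f v * Real.log (f v)

/-- `KL(f ‖ g) = ∫ f log (f / g) dv`. -/
def KL (f g : Vel d → ℝ) : ℝ := ∫ v, f v * Real.log (f v / g v)

/-- `f` is a differentiable probability density on `ℝ^d` with finite energy and entropy. -/
structure IsDensity (f : Vel d → ℝ) : Prop where
  nonneg : ∀ v, 0 ≤ f v
  differentiable : Differentiable ℝ f
  integrable : Integrable f
  integral_eq_one : ∫ v, f v = 1
  finite_energy : Integrable fun v => ‖v‖ ^ 2 * f v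
  finite_entropy : Integrable fun v => f v * Real.log (f v)

/-- The integrand `f (U[f] - U[g]) · ∇ log (f / g)`. -/
def lhsIntegrand (γ : ℝ) (f g : Vel d → ℝ) (v : Vel d) : ℝ :=
  f v * inner ℝ (U γ f v - U γ g v) (relScore f g v)

/-- The integrand `f |∇ log (f / g)|²_{A ∗ g}`. -/
def dissipationIntegrand (γ : ℝ) (f g : Vel d → ℝ) (v : Vel d) : ℝ :=
  f v * quadNormSq (convA γ g v) (relScore f g v)

/-- The integrand `f ⟨v⟩^{-γ} ‖A ∗ (f - g)‖² |∇ log f|²`. -/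
def diffusionErrorIntegrand (γ : ℝ) (f g : Vel d → ℝ) (v : Vel d) : ℝ :=
  f v * jb v ^ (-γ) * ‖convA γ (f - g) v‖ ^ 2 * ‖score f v‖ ^ 2

/-- The integrand `f ⟨v⟩^{-γ} |b ∗ (f - g)|²`. -/
def driftErrorIntegrand (γ : ℝ) (f g : Vel d → ℝ) (v : Vel d) : ℝ :=
  f v * jb v ^ (-γ) * ‖convB γ (f - g) v‖ ^ 2

/-- The left-hand side `∫ f (U[f] - U[g]) · ∇ log (f / g)` is defined and finite: for almost every
`v` with `f(v) > 0` one has `g(v) > 0` and the integrals defining `U[f](v)` and `U[g](v)` converge,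
and the outer integral converges. -/
structure LhsFinite (γ : ℝ) (f g : Vel d → ℝ) : Prop where
  pos : ∀ᵐ v, 0 < f v → 0 < g v
  field_left : ∀ᵐ v, 0 < f v → Integrable (fieldIntegrand γ f v)
  field_right : ∀ᵐ v, 0 < f v → Integrable (fieldIntegrand γ g v)
  integrable : Integrable (lhsIntegrand γ f g)

/-- The right-hand side of the general inequality is defined and finite. -/
structure RhsFinite (γ : ℝ) (f g : Vel d → ℝ) : Prop where
  convA_right : ∀ᵐ v, 0 < f v → ConvAExistsAt γ g v
  convA_sub : ∀ᵐ v, 0 < f v → ConvAExistsAt γ (f - g) v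
  convB_sub : ∀ᵐ v, 0 < f v → ConvBExistsAt γ (f - g) v
  dissipation : Integrable (dissipationIntegrand γ f g)
  diffusionError : Integrable (diffusionErrorIntegrand γ f g)
  driftError : Integrable (driftErrorIntegrand γ f g)

/-- The right-hand side of the Coulomb inequality (`d = 3`, `γ = -3`) is defined and finite. -/
structure CoulombRhsFinite (f g : Vel 3 → ℝ) : Prop where
  dissipation : Integrable (dissipationIntegrand (-3) f g)
  kl : Integrable fun v => f v * Real.log (f v / g v)
  sup_left : MemLp f ∞
  sup_right : MemLp g ∞
  fisher : MemLp (fun v => f v * jb v ^ 3 * ‖score f v‖ ^ 2) 1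
  weighted_two : MemLp (fun v => f v * jb v ^ 3) 2
  weighted_one : MemLp (fun v => f v * jb v ^ 3) 1

/-- `(‖f‖_∞ + ‖g‖_∞) (‖f ⟨v⟩³ |∇ log f|²‖_1 + ‖f ⟨v⟩³‖_2) + ‖f ⟨v⟩³‖_1`. -/
def coulombFactor (f g : Vel 3 → ℝ) : ℝ :=
  (lpNorm f ∞ volume + lpNorm g ∞ volume) *
      (lpNorm (fun v => f v * jb v ^ 3 * ‖score f v‖ ^ 2) 1 volume +
        lpNorm (fun v => f v * jb v ^ 3) 2 volume) +
    lpNorm (fun v => f v * jb v ^ 3) 1 volume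

/-- Away from the origin `b` is the divergence of `A`. -/
theorem divergence_A (γ : ℝ) {z : Vel d} (hz : z ≠ 0) :
    DifferentiableAt ℝ (A (d := d) γ) z ∧
      ∑ i, fderiv ℝ (A γ) z (EuclideanSpace.single i 1) (EuclideanSpace.single i 1) = b γ z := by
  have hn : HasFDerivAt (fun x : Vel d => ‖x‖ ^ 2) (2 • innerSL ℝ z) z :=
    (hasStrictFDerivAt_norm_sq z).hasFDerivAt
  have hz2 : ‖z‖ ^ 2 ≠ 0 := by simpa using hz
  have hp := hn.rpow_const (p := γ / 2) (Or.inl hz2)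
  have he : ∀ x : Vel d, (‖x‖ ^ 2) ^ (γ / 2) = ‖x‖ ^ γ := fun x => by
    rw [← Real.rpow_natCast, ← Real.rpow_mul (norm_nonneg x)]
    congr 1
    push_cast
    ring
  simp only [he] at hp
  have hr : HasFDerivAt (fun x : Vel d => (innerSL ℝ x).smulRight x) _ z :=
    (ContinuousLinearMap.smulRightL ℝ (Vel d) (Vel d)).hasFDerivAt_of_bilinear
      (innerSL ℝ (E := Vel d)).hasFDerivAt (hasFDerivAt_id z)
  have hA := hp.smul ((hn.smul_const (ContinuousLinearMap.id ℝ (Vel d))).sub hr)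
  have hA' : HasFDerivAt (A (d := d) γ) _ z := hA
  refine ⟨hA'.differentiableAt, ?_⟩
  rw [hA'.fderiv]
  have hi : ∀ x : Fin d, inner ℝ z (EuclideanSpace.single x (1 : ℝ)) = z x := fun x => by
    simp [EuclideanSpace.inner_single_right]
  have h1 : ∀ x : Fin d, (innerSL ℝ (EuclideanSpace.single x (1 : ℝ)))
      (EuclideanSpace.single x (1 : ℝ)) = 1 := fun x => by
    rw [innerSL_apply_apply, EuclideanSpace.inner_single_right]; simp
  have hsq : ∑ x, z x * z x = ‖z‖ ^ 2 := by
    rw [EuclideanSpace.real_norm_sq_eq]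
    exact Finset.sum_congr rfl fun x _ => (sq _).symm
  have hδ : ∀ j : Fin d, ∑ x, z x * (Pi.single x (1 : ℝ) : Fin d → ℝ) j = z j := fun j => by
    simp [Pi.single_apply]
  ext j
  simp only [b, Finset.sum_add_distrib, add_apply, sub_apply, smul_apply,
    ContinuousLinearMap.smulRight_apply, PiLp.add_apply, PiLp.smul_apply, PiLp.sub_apply,
    WithLp.ofLp_sum, Finset.sum_apply]
  simp [hi, h1]
  have e1 : ∑ x, ‖z‖ ^ γ * (2 * z x * (Pi.single x (1 : ℝ) : Fin d → ℝ) j -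
      (z x * (Pi.single x (1 : ℝ) : Fin d → ℝ) j + z j)) =
      ‖z‖ ^ γ * (∑ x, z x * (Pi.single x (1 : ℝ) : Fin d → ℝ) j - d * z j) := by
    rw [← Finset.mul_sum]
    congr 1
    rw [eq_sub_iff_add_eq, show (d : ℝ) * z j = ∑ _x : Fin d, z j by simp,
      ← Finset.sum_add_distrib]
    exact Finset.sum_congr rfl fun x _ => by ring
  have e2 : ∑ x, γ / 2 * (‖z‖ ^ 2) ^ (γ / 2 - 1) * (2 * z x) *
      (‖z‖ ^ 2 * (Pi.single x (1 : ℝ) : Fin d → ℝ) j - z x * z j) =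
      γ * (‖z‖ ^ 2) ^ (γ / 2 - 1) *
        (‖z‖ ^ 2 * ∑ x, z x * (Pi.single x (1 : ℝ) : Fin d → ℝ) j -
          (∑ x, z x * z x) * z j) := by
    rw [Finset.mul_sum, Finset.sum_mul, ← Finset.sum_sub_distrib, Finset.mul_sum]
    exact Finset.sum_congr rfl fun x _ => by ring
  rw [hδ] at e1 e2
  simp only [Pi.single_apply, mul_ite, mul_one, mul_zero] at e1 e2
  rw [e1, e2, hsq]
  ring

end Landau

end

namespace Landau

/-! Since `b` is the divergence of `A`, integration by parts gives `∫ A(v - w) ∇h(w) dw = (b ∗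
h)(v)` (`integral_A_gradient`). Applied to `h = f - g`, it yields (`U_sub_U`) `U[f] - U[g] = -(A ∗
(f - g)) ∇log f - (A ∗ g) ∇log(f/g) + b ∗ (f - g)`. Paired with `∇log(f/g)`, the middle term is
minus the full dissipation. The other two are absorbed by Young's inequality into half of it,
because `A ∗ g ≥ c ⟨v⟩^γ I` (`exists_le_quadNormSq_convA`); the weight `⟨v⟩^{-γ}` in the errors is
the inverse of this lower bound. For coercivity, the energy bound keeps mass `3/4` of `g` in a ball,
the entropy bound leaves at most `1/4` in a thin tube about the line `v + ℝx`, and off the tube `x ·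
A(v - w) x` is bounded below. When `d < 2` the kernel vanishes and nothing is to be shown.

In the Coulomb case the errors are bounded by the `L¹` and `L²` norms of `f - g` through
Cauchy-Schwarz, using local integrability of `|z|^{-8/3}` in `ℝ³` (`enorm_convA_coulomb_le`,
`lintegral_mul_enorm_convB_coulomb_le`). Both norms are controlled by the relative entropy via `∫ (f
- g)²/(f + g) ≤ 2 KL` (`lintegral_sq_sub_div_add_le`). The `L¹` part of the bound on `A ∗ (f - g)`
comes without a sup norm factor; it is supplied by the lower bound of `‖g‖_∞` in terms of the
energy. -/

/-! ### Divergence theorem and integration by parts against the kernel. -/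

/-- The integral of the divergence of a compactly supported differentiable vector field vanishes,
as soon as the divergence is integrable. -/
theorem integral_divergence_eq_zero {d : ℕ} {X : Vel d → Vel d} (hX : Differentiable ℝ X)
    (hc : HasCompactSupport X)
    (hi : Integrable fun w => ∑ i, fderiv ℝ X w (EuclideanSpace.single i 1) i) :
    ∫ w, ∑ i, fderiv ℝ X w (EuclideanSpace.single i 1) i = 0 := by
  cases d with
  | zero => simp
  | succ n =>
  obtain ⟨R, hR0, hR⟩ := hc.isCompact.isBounded.subset_ball_lt 0 0
  have hX0 : ∀ w : Vel (n + 1), R ≤ ‖w‖ → X w = 0 := fun w hw =>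
    image_eq_zero_of_notMem_tsupport fun h => by
      have := hR h
      rw [mem_ball_zero_iff] at this
      linarith
  have hX1 : ∀ w : Vel (n + 1), R ≤ ‖w‖ → fderiv ℝ X w = 0 := fun w hw =>
    image_eq_zero_of_notMem_tsupport fun h => by
      have := hR (tsupport_fderiv_subset ℝ h)
      rw [mem_ball_zero_iff] at this
      linarith
  let e := EuclideanSpace.equiv (Fin (n + 1)) ℝ
  have mp := PiLp.volume_preserving_toLp (Fin (n + 1))
  have emb : MeasurableEmbedding (WithLp.toLp 2 : (Fin (n + 1) → ℝ) → Vel (n + 1)) :=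
    (MeasurableEquiv.toLp 2 (Fin (n + 1) → ℝ)).measurableEmbedding
  let f : (Fin (n + 1) → ℝ) → (Fin (n + 1) → ℝ) := fun x => e (X (e.symm x))
  let f' : (Fin (n + 1) → ℝ) → (Fin (n + 1) → ℝ) →L[ℝ] (Fin (n + 1) → ℝ) := fun x =>
    (e : Vel (n + 1) →L[ℝ] _) ∘L (fderiv ℝ X (e.symm x)) ∘L (e.symm : _ →L[ℝ] Vel (n + 1))
  have hf : ∀ x, HasFDerivAt f (f' x) x := fun x =>
    e.hasFDerivAt.comp x (((hX _).hasFDerivAt).comp x e.symm.hasFDerivAt)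
  have hdiv : ∀ x, ∑ i, f' x (Pi.single i 1) i =
      ∑ i, fderiv ℝ X (WithLp.toLp 2 x) (EuclideanSpace.single i 1) i := fun x => rfl
  have hi' : Integrable fun x => ∑ i, f' x (Pi.single i 1) i := by
    simp only [hdiv]
    exact (mp.integrable_comp_emb emb).2 hi
  have hcoord : ∀ (x : Fin (n + 1) → ℝ) i, |x i| ≤ ‖(WithLp.toLp 2 x : Vel (n + 1))‖ :=
    fun x i => PiLp.norm_apply_le (WithLp.toLp 2 x : Vel (n + 1)) i
  -- This form of the divergence theorem needs differentiability and an integrable divergence only,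
  -- not continuous derivatives; `X` vanishes on the faces of the box.
  have key := integral_divergence_of_hasFDerivAt_off_countable (fun _ => -R) (fun _ => R)
    (fun _ => by simpa using hR0.le) f f' ∅ Set.countable_empty
    (fun x _ => (hf x).continuousAt.continuousWithinAt) (fun x _ => hf x) hi'.integrableOn
  have hface : ∀ (x : Fin (n + 1) → ℝ) i, |x i| = R → f x i = 0 := fun x i hx => by
    have : X (e.symm x) = 0 := hX0 _ (hx ▸ hcoord x i)
    simp [f, this]
  rw [Finset.sum_eq_zero, setIntegral_eq_integral_of_forall_compl_eq_zero] at key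
  · rw [← mp.integral_comp emb]
    exact key
  · intro x hx
    have : ∃ i, R ≤ |x i| := by
      by_contra! h
      exact hx ⟨fun i => (abs_lt.1 (h i)).1.le, fun i => (abs_lt.1 (h i)).2.le⟩
    obtain ⟨i, hi⟩ := this
    rw [hdiv, hX1 _ (hi.trans (hcoord x i))]
    simp
  · intro i _
    rw [integral_eq_zero_of_ae, integral_eq_zero_of_ae, sub_zero]
    · exact .of_forall fun x => hface _ i (by simp [abs_of_pos hR0])
    · exact .of_forall fun x => hface _ i (by simp [abs_of_pos hR0])

variable {d : ℕ}

theorem A_apply (γ : ℝ) (z x : Vel d) :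
    A γ z x = ‖z‖ ^ γ • (‖z‖ ^ 2 • x - inner ℝ z x • z) := by
  simp [A]

/-- A differentiable cutoff of the power `s ^ p`, supported in `[1 / n, n]`. -/
noncomputable def powCutoff (p : ℝ) (n : ℕ) (s : ℝ) : ℝ :=
  Real.smoothTransition (n * s - 1) * Real.smoothTransition (n - s) * s ^ p

theorem differentiable_powCutoff (p : ℝ) (n : ℕ) : Differentiable ℝ (powCutoff p n) := by
  have hT : Differentiable ℝ Real.smoothTransition :=
    (Real.smoothTransition.contDiff (n := 1)).differentiable (by norm_num)
  intro s
  by_cases hs : s = 0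
  · subst hs
    have : powCutoff p n =ᶠ[nhds 0] fun _ => 0 := by
      have h : ∀ᶠ s : ℝ in nhds 0, n * s - 1 < 0 :=
        ContinuousAt.eventually_lt (by fun_prop) continuousAt_const (by simp)
      filter_upwards [h] with s hs
      simp [powCutoff, Real.smoothTransition.zero_of_nonpos hs.le]
    exact this.differentiableAt_iff.2 (differentiableAt_const _)
  · have : DifferentiableAt ℝ (fun s : ℝ => s ^ p) s :=
      (Real.hasDerivAt_rpow_const (Or.inl hs)).differentiableAt
    unfold powCutoff
    refine DifferentiableAt.mul (DifferentiableAt.mul ?_ ?_) this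
    · exact (hT _).comp s (by fun_prop)
    · exact (hT _).comp s (by fun_prop)

theorem powCutoff_eq_zero (p : ℝ) {n : ℕ} {s : ℝ} (hs : n ≤ s) : powCutoff p n s = 0 := by
  simp [powCutoff, Real.smoothTransition.zero_of_nonpos (sub_nonpos.2 hs)]

theorem powCutoff_eq (γ : ℝ) (n : ℕ) (z : Vel d) :
    ∃ c : ℝ, 0 ≤ c ∧ c ≤ 1 ∧ powCutoff (γ / 2) n (‖z‖ ^ 2) = c * ‖z‖ ^ γ := by
  refine ⟨Real.smoothTransition (n * ‖z‖ ^ 2 - 1) * Real.smoothTransition (n - ‖z‖ ^ 2),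
    mul_nonneg (Real.smoothTransition.nonneg _) (Real.smoothTransition.nonneg _),
    mul_le_one₀ (Real.smoothTransition.le_one _) (Real.smoothTransition.nonneg _)
      (Real.smoothTransition.le_one _), ?_⟩
  rw [powCutoff, ← Real.rpow_natCast ‖z‖ 2, ← Real.rpow_mul (norm_nonneg z)]
  congr 2
  push_cast
  ring

theorem eventually_powCutoff_eq (γ : ℝ) {z : Vel d} (hz : z ≠ 0) :
    ∀ᶠ n : ℕ in Filter.atTop, powCutoff (γ / 2) n (‖z‖ ^ 2) = ‖z‖ ^ γ := by
  have hz2 : 0 < ‖z‖ ^ 2 := by positivity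
  filter_upwards [Filter.eventually_ge_atTop ⌈2 / ‖z‖ ^ 2⌉₊,
    Filter.eventually_ge_atTop ⌈1 + ‖z‖ ^ 2⌉₊] with n h1 h2
  have h1 := Nat.ceil_le.1 h1
  have h2 := Nat.ceil_le.1 h2
  rw [div_le_iff₀ hz2] at h1
  rw [powCutoff, Real.smoothTransition.one_of_one_le (by linarith),
    Real.smoothTransition.one_of_one_le (by linarith), one_mul, one_mul,
    ← Real.rpow_natCast ‖z‖ 2, ← Real.rpow_mul (norm_nonneg z)]
  congr 1
  push_cast
  ring

theorem fderiv_eq_inner_gradient {f : Vel d → ℝ} {w : Vel d} (y : Vel d) :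
    fderiv ℝ f w y = inner ℝ (gradient f w) y := by
  simp [gradient]

/-- The divergence of the vector field `w ↦ ψ(|v - w|²) h(w) (|z|² e - ⟨z, e⟩ z)`, `z = v - w`:
the derivative of `ψ` drops out since `|z|² I - z ⊗ z` annihilates `z`. -/
theorem divergence_radial_mul {ψ : ℝ → ℝ} (hψ : Differentiable ℝ ψ) {h : Vel d → ℝ}
    (hh : Differentiable ℝ h) (v e w : Vel d) :
    let X : Vel d → Vel d := fun w =>
      (ψ (‖v - w‖ ^ 2) * h w) • (‖v - w‖ ^ 2 • e - inner ℝ (v - w) e • (v - w))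
    DifferentiableAt ℝ X w ∧
      ∑ i, fderiv ℝ X w (EuclideanSpace.single i 1) i =
        ψ (‖v - w‖ ^ 2) * inner ℝ e
          (‖v - w‖ ^ 2 • gradient h w - inner ℝ (v - w) (gradient h w) • (v - w)) +
        ψ (‖v - w‖ ^ 2) * h w * ((d - 1) * inner ℝ (v - w) e) := by
  intro X
  have hz : HasFDerivAt (fun w : Vel d => v - w) (-ContinuousLinearMap.id ℝ (Vel d)) w :=
    (hasFDerivAt_id w).const_sub v
  have hn : HasFDerivAt (fun w : Vel d => ‖v - w‖ ^ 2)
      ((2 • innerSL ℝ (v - w)) ∘L (-ContinuousLinearMap.id ℝ (Vel d))) w :=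
    (hasStrictFDerivAt_norm_sq (v - w)).hasFDerivAt.comp w hz
  have hψ' := (hψ (‖v - w‖ ^ 2)).hasDerivAt.comp_hasFDerivAt w hn
  have hin : HasFDerivAt (fun w : Vel d => inner ℝ (v - w) e)
      ((innerSL ℝ e) ∘L (-ContinuousLinearMap.id ℝ (Vel d))) w := by
    have := (innerSL ℝ e).hasFDerivAt.comp w hz
    refine this.congr_of_eventuallyEq (.of_forall fun x => ?_)
    simp [real_inner_comm]
  have hX := (hψ'.mul (hh w).hasFDerivAt).smul ((hn.smul_const e).sub (hin.smul hz))
  have hX' : HasFDerivAt X _ w := hX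
  refine ⟨hX'.differentiableAt, ?_⟩
  rw [hX'.fderiv]
  set z := v - w
  have hi : ∀ (u : Vel d) (i : Fin d), inner ℝ u (EuclideanSpace.single i (1 : ℝ)) = u i :=
    fun u i => by simp [EuclideanSpace.inner_single_right]
  have hs : ∀ u u' : Vel d, inner ℝ u u' = ∑ i, u i * u' i := fun u u' => by
    rw [PiLp.inner_apply]
    exact Finset.sum_congr rfl fun i _ => by simp [mul_comm]
  have hzz : ‖z‖ ^ 2 = ∑ i, z i * z i := by rw [← hs, real_inner_self_eq_norm_sq]
  simp only [Function.comp, add_apply, sub_apply, smul_apply, neg_apply,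
    ContinuousLinearMap.comp_apply, ContinuousLinearMap.id_apply,
    ContinuousLinearMap.smulRight_apply, PiLp.add_apply, PiLp.smul_apply, PiLp.sub_apply,
    PiLp.neg_apply, map_neg, innerSL_apply_apply, hi, fderiv_eq_inner_gradient, smul_eq_mul,
    inner_sub_right, inner_smul_right, nsmul_eq_mul]
  have h1 : ∀ i : Fin d, (EuclideanSpace.single i (1 : ℝ)).ofLp i = 1 := fun i => by simp
  simp only [h1]
  have key : ∀ p q r N I : ℝ, ∑ i, (p * q * (-(2 * z i) * e i - (I * -1 + -e i * z i)) +
      (p * (gradient h w) i + q * (r * -(2 * z i))) * (N * e i - I * z i)) =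
      p * q * (d * I) - p * q * (∑ i, z i * e i) + p * N * (∑ i, e i * (gradient h w) i) -
        p * I * (∑ i, z i * (gradient h w) i) - 2 * q * r * N * (∑ i, z i * e i) +
        2 * q * r * I * (∑ i, z i * z i) := fun p q r N I => by
    rw [show (d : ℝ) * I = ∑ _i : Fin d, I by simp]
    simp only [Finset.mul_sum, ← Finset.sum_add_distrib, ← Finset.sum_sub_distrib]
    exact Finset.sum_congr rfl fun i _ => by ring
  refine (key (ψ (‖z‖ ^ 2)) (h w) (deriv ψ (‖z‖ ^ 2)) (‖z‖ ^ 2) (inner ℝ z e)).trans ?_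
  rw [← hzz, ← hs, ← hs, ← hs, real_inner_comm z e]
  ring

/-- The factor `|z|^γ` is cut off near `z = 0` and near infinity by a function of `|z|²`. As `|z|² I
- z ⊗ z` annihilates `z`, the cutoff leaves no commutator: the truncated divergence is the full
integrand times a number in `[0, 1]`. Dominated convergence then needs only the convergence of the
two integrals, with no decay of `h`. -/
theorem integral_A_gradient (γ : ℝ) {h : Vel d → ℝ} (hh : Differentiable ℝ h) (v : Vel d)
    (hA : Integrable fun w => A γ (v - w) (gradient h w))
    (hb : Integrable fun w => h w • b γ (v - w)) :
    ∫ w, A γ (v - w) (gradient h w) = ∫ w, h w • b γ (v - w) := by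
  rcases Nat.eq_zero_or_pos d with rfl | hd
  · exact Subsingleton.elim _ _
  -- For `d > 0` the volume has no atoms, so the singular point `w = v` is negligible.
  have : Nonempty (Fin d) := ⟨⟨0, hd⟩⟩
  refine ext_inner_left ℝ fun e => ?_
  rw [← integral_inner hA, ← integral_inner hb, ← sub_eq_zero,
    ← integral_sub (hA.const_inner e) (hb.const_inner e)]
  let F : Vel d → ℝ := fun w => inner ℝ e (A γ (v - w) (gradient h w)) -
    inner ℝ e (h w • b γ (v - w))
  have hF : Integrable F := (hA.const_inner e).sub (hb.const_inner e)
  change ∫ w, F w = 0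
  let D : ℕ → Vel d → ℝ := fun n w => ∑ i, fderiv ℝ (fun w : Vel d =>
    (powCutoff (γ / 2) n (‖v - w‖ ^ 2) * h w) •
      (‖v - w‖ ^ 2 • e - inner ℝ (v - w) e • (v - w))) w (EuclideanSpace.single i 1) i
  have hD : ∀ n w, D n w = powCutoff (γ / 2) n (‖v - w‖ ^ 2) * (inner ℝ e
      (‖v - w‖ ^ 2 • gradient h w - inner ℝ (v - w) (gradient h w) • (v - w)) +
        h w * ((d - 1) * inner ℝ (v - w) e)) := fun n w => by
    refine (divergence_radial_mul (differentiable_powCutoff (γ / 2) n) hh v e w).2.trans ?_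
    ring
  have hF' : ∀ w, F w = ‖v - w‖ ^ γ * (inner ℝ e
      (‖v - w‖ ^ 2 • gradient h w - inner ℝ (v - w) (gradient h w) • (v - w)) +
        h w * ((d - 1) * inner ℝ (v - w) e)) := fun w => by
    simp only [F, A_apply, b, inner_smul_right, real_inner_comm e (v - w)]
    ring
  have hDF : ∀ n w, ‖D n w‖ ≤ ‖F w‖ := fun n w => by
    obtain ⟨c, hc0, hc1, hc⟩ := powCutoff_eq γ n (v - w)
    rw [hD, hc, mul_assoc, ← hF', norm_mul, Real.norm_of_nonneg hc0]
    exact mul_le_of_le_one_left (norm_nonneg _) hc1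
  have hmeas : ∀ n, AEStronglyMeasurable (D n) := fun n => by
    refine Measurable.aestronglyMeasurable (Finset.measurable_sum _ fun i _ => ?_)
    have := measurable_fderiv_apply_const ℝ (fun w : Vel d =>
      (powCutoff (γ / 2) n (‖v - w‖ ^ 2) * h w) •
      (‖v - w‖ ^ 2 • e - inner ℝ (v - w) e • (v - w))) (EuclideanSpace.single i 1)
    exact (EuclideanSpace.proj (𝕜 := ℝ) i).continuous.measurable.comp this
  have hlim : Filter.Tendsto (fun n => ∫ w, D n w) Filter.atTop (nhds (∫ w, F w)) := by
    refine tendsto_integral_of_dominated_convergence (fun w => ‖F w‖) hmeas hF.norm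
      (fun n => .of_forall (hDF n)) ?_
    filter_upwards [compl_mem_ae_iff.2 (measure_singleton v)] with w hw
    have hz : v - w ≠ 0 := fun h0 => hw (sub_eq_zero.1 h0).symm
    refine tendsto_const_nhds.congr' ?_
    filter_upwards [eventually_powCutoff_eq γ hz] with n hn
    rw [hD, hn, hF']
  have hzero : ∀ n, ∫ w, D n w = 0 := fun n => by
    refine integral_divergence_eq_zero
      (fun w => (divergence_radial_mul (differentiable_powCutoff (γ / 2) n) hh v e w).1) ?_
      (hF.mono (hmeas n) (.of_forall (hDF n)))
    refine HasCompactSupport.of_support_subset_isCompact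
      (isCompact_closedBall v (Real.sqrt n)) fun w hw => ?_
    rw [mem_closedBall_iff_norm, norm_sub_rev]
    by_contra! hlt
    refine hw ?_
    have := powCutoff_eq_zero (γ / 2) (n := n) (s := ‖v - w‖ ^ 2)
      ((Real.sqrt_le_left (norm_nonneg _)).1 hlt.le)
    simp [this]
  simp only [hzero] at hlim
  exact (tendsto_nhds_unique hlim tendsto_const_nhds)

/-! ### Coercivity of `A ∗ g` from energy and entropy. -/

/-- Young's inequality for the conjugate pair `t log t - t` and `exp s`, with the term `-t` dropped.
-/
theorem mul_sub_exp_le_mul_log {t : ℝ} (ht : 0 ≤ t) (s : ℝ) :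
    t * s - Real.exp s ≤ t * Real.log t := by
  rcases ht.eq_or_lt with rfl | ht
  · simpa using (Real.exp_pos s).le
  · have h1 := Real.add_one_le_exp (s - Real.log t)
    rw [Real.exp_sub, Real.exp_log ht, le_div_iff₀ ht] at h1
    nlinarith

theorem integrable_exp_neg_norm_sq : Integrable fun w : Vel d => Real.exp (-‖w‖ ^ 2) := by
  refine Integrable.of_integral_ne_zero ?_
  have := GaussianFourier.integral_rexp_neg_mul_sq_norm (V := Vel d) one_pos
  simp only [neg_mul, one_mul] at this
  rw [this]
  positivity

/-- Bounds on the energy and the entropy prevent concentration on small sets. -/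
theorem exists_setIntegral_le_of_volume_le (d : ℕ) (E H : ℝ) {ε : ℝ} (hε : 0 < ε) :
    ∃ η : ℝ, 0 < η ∧ ∀ g : Vel d → ℝ, IsDensity g → energy g ≤ E → entropy g ≤ H →
      ∀ S : Set (Vel d), MeasurableSet S → volume S ≤ ENNReal.ofReal η → ∫ w in S, g w ≤ ε := by
  set G := ∫ w : Vel d, Real.exp (-‖w‖ ^ 2)
  -- The argument ends with `L ∫_S g ≤ H + 2E + G + 1`, where the `1` bounds `|S| e^L` and explains
  -- the choice `η = e^{-L}`.
  obtain ⟨L, hL0, hL⟩ : ∃ L : ℝ, 0 < L ∧ H + 2 * E + G + 1 ≤ L * ε := by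
    refine ⟨max (H + 2 * E + G + 1) 1 / ε, by positivity, ?_⟩
    rw [div_mul_cancel₀ _ hε.ne']
    exact le_max_left _ _
  refine ⟨Real.exp (-L), Real.exp_pos _, fun g hg hE hH S hS hvol => ?_⟩
  have hSfin : volume S ≠ ∞ := (hvol.trans_lt ENNReal.ofReal_lt_top).ne
  have hvol' : volume.real S ≤ Real.exp (-L) :=
    ENNReal.toReal_le_of_le_ofReal (Real.exp_pos _).le hvol
  have i1 : Integrable (S.indicator g) := hg.integrable.indicator hS
  have i2 : Integrable (S.indicator fun _ : Vel d => Real.exp L) :=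
    (integrable_indicator_iff hS).2 (integrableOn_const hSfin)
  -- Young's inequality with `s = L - |w|²` on `S` and `s = -|w|²` off `S`; the latter controls the
  -- negative part of `g log g`.
  have hpt : ∀ w, L * S.indicator g w ≤ g w * Real.log (g w) + ‖w‖ ^ 2 * g w +
      Real.exp (-‖w‖ ^ 2) + S.indicator (fun _ => Real.exp L) w := fun w => by
    by_cases hw : w ∈ S
    · have h1 := mul_sub_exp_le_mul_log (hg.nonneg w) (L - ‖w‖ ^ 2)
      have h2 : Real.exp (L - ‖w‖ ^ 2) ≤ Real.exp L := Real.exp_le_exp.2 (by nlinarith [sq_nonneg ‖w‖])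
      simp only [Set.indicator_of_mem hw]
      nlinarith [Real.exp_pos (-‖w‖ ^ 2)]
    · have h1 := mul_sub_exp_le_mul_log (hg.nonneg w) (-‖w‖ ^ 2)
      simp only [Set.indicator_of_notMem hw]
      nlinarith
  have hint := integral_mono (i1.const_mul L) (((hg.finite_entropy.add hg.finite_energy).add
    integrable_exp_neg_norm_sq).add i2) hpt
  have e1 : ∫ w, ‖w‖ ^ 2 * g w = 2 * energy g := by rw [energy]; ring
  have e2 : ∫ w, S.indicator (fun _ : Vel d => Real.exp L) w = volume.real S * Real.exp L := by
    rw [integral_indicator hS, setIntegral_const, smul_eq_mul]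
  rw [integral_const_mul, integral_indicator hS, integral_add' ((hg.finite_entropy.add
      hg.finite_energy).add integrable_exp_neg_norm_sq) i2,
    integral_add' (hg.finite_entropy.add hg.finite_energy) integrable_exp_neg_norm_sq,
    integral_add' hg.finite_entropy hg.finite_energy, e1, e2] at hint
  have h3 : volume.real S * Real.exp L ≤ 1 := by
    calc _ ≤ Real.exp (-L) * Real.exp L := by gcongr
      _ = 1 := by rw [← Real.exp_add]; simp
  refine le_of_mul_le_mul_left ?_ hL0
  have : entropy g = ∫ v, g v * Real.log (g v) := rfl
  linarith

/-- A bound on the energy keeps most of the mass in a ball. -/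
theorem exists_le_setIntegral_ball (d : ℕ) (E : ℝ) :
    ∃ R : ℝ, 0 < R ∧ ∀ g : Vel d → ℝ, IsDensity g → energy g ≤ E →
      3 / 4 ≤ ∫ w in Metric.ball 0 R, g w := by
  -- Chebyshev: the mass outside the ball is at most `2E / R² ≤ 1/4`.
  refine ⟨Real.sqrt (8 * (|E| + 1)), by positivity, fun g hg hE => ?_⟩
  set R := Real.sqrt (8 * (|E| + 1))
  have hR : R ^ 2 = 8 * (|E| + 1) := Real.sq_sqrt (by positivity)
  have hpt : ∀ w, R ^ 2 * (g w - (Metric.ball (0 : Vel d) R).indicator g w) ≤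
      ‖w‖ ^ 2 * g w := fun w => by
    by_cases hw : w ∈ Metric.ball (0 : Vel d) R
    · rw [Set.indicator_of_mem hw, sub_self, mul_zero]
      exact mul_nonneg (sq_nonneg _) (hg.nonneg w)
    · rw [Set.indicator_of_notMem hw, sub_zero]
      rw [mem_ball_zero_iff, not_lt] at hw
      exact mul_le_mul_of_nonneg_right (pow_le_pow_left₀ (Real.sqrt_nonneg _) hw 2) (hg.nonneg w)
  have i1 : Integrable ((Metric.ball (0 : Vel d) R).indicator g) :=
    hg.integrable.indicator measurableSet_ball
  have hint := integral_mono ((hg.integrable.sub i1).const_mul (R ^ 2)) hg.finite_energy hpt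
  have e1 : ∫ w, ‖w‖ ^ 2 * g w = 2 * energy g := by rw [energy]; ring
  simp only [Pi.sub_apply] at hint
  rw [integral_const_mul, integral_sub hg.integrable i1, integral_indicator measurableSet_ball,
    hg.integral_eq_one, e1, hR] at hint
  nlinarith [le_abs_self E, abs_nonneg E]

/-- Thin tubes in a ball have small volume, uniformly in the axis `v + ℝ x`. -/
theorem exists_volume_tube_le (hd : 2 ≤ d) {R η : ℝ} (hR : 0 < R) (hη : 0 < η) :
    ∃ δ : ℝ, 0 < δ ∧ ∀ v x : Vel d, x ≠ 0 →
      volume {w : Vel d | ‖w‖ < R ∧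
        ‖v - w‖ ^ 2 * ‖x‖ ^ 2 - inner ℝ (v - w) x ^ 2 < δ ^ 2 * ‖x‖ ^ 2} ≤ ENNReal.ofReal η := by
  -- Makes `2δ (2R)^{d-1} = η`, the volume of a box with one side `2δ` and the others `2R`.
  refine ⟨η / (2 * (2 * R) ^ (d - 1)), by positivity, fun v x hx => ?_⟩
  set δ := η / (2 * (2 * R) ^ (d - 1))
  have hδ : 0 < δ := by positivity
  have hx' : 0 < ‖x‖ := norm_pos_iff.2 hx
  let i₀ : Fin d := ⟨0, by omega⟩
  let j : Fin d := ⟨1, by omega⟩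
  have hij : i₀ ≠ j := by simp [i₀, j, Fin.ext_iff]
  obtain ⟨B, hB⟩ := Orthonormal.exists_orthonormalBasis_extension_of_card_eq (𝕜 := ℝ)
    (E := Vel d) (ι := Fin d) (by simp) (v := fun _ => ‖x‖⁻¹ • x) (s := {i₀}) (by
      refine ⟨fun i => ?_, fun i k hik => (hik (Subsingleton.elim _ _)).elim⟩
      simp [norm_smul, hx'.ne'])
  have hBx : x = ‖x‖ • B i₀ := by
    rw [hB i₀ rfl, smul_smul, mul_inv_cancel₀ hx'.ne', one_smul]
  -- One direction `B j` orthogonal to the axis suffices; this is where `d ≥ 2` enters. The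
  -- component of `v - w` along `B j` is at most the distance to the axis.
  let lo : Fin d → ℝ := fun k => if k = j then inner ℝ (B j) v - δ else -R
  let hi : Fin d → ℝ := fun k => if k = j then inner ℝ (B j) v + δ else R
  have hsub : {w : Vel d | ‖w‖ < R ∧
      ‖v - w‖ ^ 2 * ‖x‖ ^ 2 - inner ℝ (v - w) x ^ 2 < δ ^ 2 * ‖x‖ ^ 2} ⊆
      (fun w => WithLp.ofLp (B.repr w)) ⁻¹' (Set.univ.pi fun k => Set.Ioo (lo k) (hi k)) := by
    rintro w ⟨hw, hw'⟩ k -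
    simp only [lo, hi, B.repr_apply_apply]
    split_ifs with hk
    · subst hk
      have hsum := B.sum_sq_norm_inner_right (v - w)
      have h2 : ‖inner ℝ (B i₀) (v - w)‖ ^ 2 + ‖inner ℝ (B j) (v - w)‖ ^ 2 ≤ ‖v - w‖ ^ 2 := by
        rw [← hsum, ← Finset.sum_pair (f := fun i => ‖(inner ℝ (B i) (v - w) : ℝ)‖ ^ 2) hij]
        exact Finset.sum_le_sum_of_subset_of_nonneg (Finset.subset_univ _)
          fun _ _ _ => sq_nonneg _
      have h3 : inner ℝ (v - w) x ^ 2 = ‖x‖ ^ 2 * inner ℝ (B i₀) (v - w) ^ 2 := by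
        conv_lhs => rw [hBx]
        rw [inner_smul_right, real_inner_comm]
        ring
      rw [h3] at hw'
      simp only [Real.norm_eq_abs, sq_abs] at h2
      have h4 : inner ℝ (B j) (v - w) ^ 2 < δ ^ 2 := by
        have : 0 < ‖x‖ ^ 2 := by positivity
        nlinarith
      have h5 := abs_lt_of_sq_lt_sq h4 hδ.le
      rw [inner_sub_right, abs_lt] at h5
      constructor <;> linarith [h5.1, h5.2]
    · have h1 : |inner ℝ (B k) w| ≤ ‖w‖ := by
        simpa using abs_real_inner_le_norm (B k) w
      exact abs_lt.1 (h1.trans_lt hw)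
  have mp : MeasurePreserving (fun w => WithLp.ofLp (B.repr w)) :=
    (PiLp.volume_preserving_ofLp (Fin d)).comp B.measurePreserving_repr
  refine (measure_mono hsub).trans ?_
  rw [mp.measure_preimage (MeasurableSet.univ_pi fun _ => measurableSet_Ioo).nullMeasurableSet,
    Real.volume_pi_Ioo, ← Finset.mul_prod_erase _ _ (Finset.mem_univ j),
    Finset.prod_congr rfl (g := fun _ => ENNReal.ofReal (2 * R)), Finset.prod_const,
    Finset.card_erase_of_mem (Finset.mem_univ j), Finset.card_univ, Fintype.card_fin,
    ← ENNReal.ofReal_pow (by positivity), ← ENNReal.ofReal_mul (by simp [lo, hi]; linarith)]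
  · refine ENNReal.ofReal_le_ofReal (le_of_eq ?_)
    simp only [lo, hi, if_true, δ]
    field_simp
    ring
  · intro k hk
    simp only [lo, hi, if_neg (Finset.ne_of_mem_erase hk)]
    congr 1
    ring

theorem inner_A_apply (γ : ℝ) (z x : Vel d) :
    inner ℝ x (A γ z x) = ‖z‖ ^ γ * (‖z‖ ^ 2 * ‖x‖ ^ 2 - inner ℝ z x ^ 2) := by
  rw [A_apply, inner_smul_right, inner_sub_right, inner_smul_right, inner_smul_right,
    real_inner_self_eq_norm_sq, real_inner_comm]
  ring

theorem inner_A_apply_nonneg (γ : ℝ) (z x : Vel d) : 0 ≤ inner ℝ x (A γ z x) := by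
  rw [inner_A_apply]
  refine mul_nonneg (Real.rpow_nonneg (norm_nonneg _) _) ?_
  have h := abs_real_inner_le_norm z x
  have h1 := sq_le_sq' (by linarith [neg_abs_le (inner ℝ z x), abs_nonneg (inner ℝ z x)])
    ((le_abs_self _).trans h)
  nlinarith

theorem convA_apply_eq_integral {γ : ℝ} {h : Vel d → ℝ} {v : Vel d} (hA : ConvAExistsAt γ h v)
    (x : Vel d) : convA γ h v x = ∫ w, h w • A γ (v - w) x := by
  have hA' : Integrable fun w => h w • A (d := d) γ (v - w) := hA
  rw [convA, convolution_def]
  simp only [ContinuousLinearMap.lsmul_apply]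
  exact ContinuousLinearMap.integral_apply hA' x

theorem one_le_jb (v : Vel d) : 1 ≤ jb v := by
  rw [jb, Real.one_le_sqrt]
  nlinarith [sq_nonneg ‖v‖]

theorem norm_le_jb (v : Vel d) : ‖v‖ ≤ jb v :=
  Real.le_sqrt_of_sq_le (by linarith)

/-- Coercivity of the diffusion matrix `A ∗ g`, in terms of the energy and entropy of `g`. -/
theorem exists_le_quadNormSq_convA (hd : 2 ≤ d) {γ : ℝ} (hγ : γ ≤ 0) (E H : ℝ) :
    ∃ c : ℝ, 0 < c ∧ ∀ g : Vel d → ℝ, IsDensity g → energy g ≤ E → entropy g ≤ H →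
      ∀ v : Vel d, ConvAExistsAt γ g v → ∀ x : Vel d,
        c * jb v ^ γ * ‖x‖ ^ 2 ≤ quadNormSq (convA γ g v) x := by
  obtain ⟨R, hR, hball⟩ := exists_le_setIntegral_ball d E
  obtain ⟨η, hη, hconc⟩ := exists_setIntegral_le_of_volume_le d E H (ε := 1 / 4) (by norm_num)
  obtain ⟨δ, hδ, htube⟩ := exists_volume_tube_le hd hR hη
  refine ⟨1 / 2 * ((1 + R) ^ γ * δ ^ 2), by positivity, fun g hg hE hH v hA x => ?_⟩
  rcases eq_or_ne x 0 with rfl | hx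
  · simp [quadNormSq]
  have hx' : 0 < ‖x‖ := norm_pos_iff.2 hx
  have hA' : Integrable fun w => g w • A (d := d) γ (v - w) := hA
  have hAx : Integrable fun w => g w • A γ (v - w) x :=
    (ContinuousLinearMap.apply ℝ (Vel d) x).integrable_comp hA'
  rw [quadNormSq, convA_apply_eq_integral hA, ← integral_inner hAx]
  set S := {w : Vel d | ‖w‖ < R ∧
    ‖v - w‖ ^ 2 * ‖x‖ ^ 2 - inner ℝ (v - w) x ^ 2 < δ ^ 2 * ‖x‖ ^ 2} with hSdef
  have hSm : MeasurableSet S := by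
    have h1 : IsOpen {w : Vel d | ‖w‖ < R} := isOpen_lt (by fun_prop) (by fun_prop)
    have h2 : IsOpen {w : Vel d |
        ‖v - w‖ ^ 2 * ‖x‖ ^ 2 - inner ℝ (v - w) x ^ 2 < δ ^ 2 * ‖x‖ ^ 2} :=
      isOpen_lt (by fun_prop) (by fun_prop)
    exact (h1.inter h2).measurableSet
  have hSB : S ⊆ Metric.ball 0 R := fun w hw => by simpa using hw.1
  set T := Metric.ball (0 : Vel d) R \ S
  have hTm : MeasurableSet T := measurableSet_ball.diff hSm
  have hmass : 1 / 2 ≤ ∫ w in T, g w := by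
    have h1 := setIntegral_sdiff (μ := volume) hSm hg.integrable.integrableOn hSB
    have h2 := hconc g hg hE hH S hSm (htube v x hx)
    have h3 := hball g hg hE
    linarith
  set κ := (1 + R) ^ γ * δ ^ 2 * jb v ^ γ * ‖x‖ ^ 2
  have hjb : 0 < jb v := one_pos.trans_le (one_le_jb v)
  have hκ : 0 ≤ κ := by positivity
  have hpt : ∀ w, κ * T.indicator g w ≤ inner ℝ x (g w • A γ (v - w) x) := fun w => by
    rw [inner_smul_right]
    by_cases hw : w ∈ T
    · rw [Set.indicator_of_mem hw, mul_comm]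
      refine mul_le_mul_of_nonneg_left ?_ (hg.nonneg w)
      have hwR : ‖w‖ < R := by simpa using hw.1
      have hwS : δ ^ 2 * ‖x‖ ^ 2 ≤ ‖v - w‖ ^ 2 * ‖x‖ ^ 2 - inner ℝ (v - w) x ^ 2 := by
        by_contra! h
        exact hw.2 ⟨hwR, h⟩
      -- Off the tube `w ≠ v`, so the decreasing power may be compared without meeting the value of
      -- `0 ^ γ`.
      have hz : 0 < ‖v - w‖ := by
        rw [norm_pos_iff]
        intro h0
        rw [h0] at hwS
        simp only [norm_zero, inner_zero_left] at hwS
        nlinarith [mul_pos (pow_pos hδ 2) (pow_pos hx' 2)]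
      have hzle : ‖v - w‖ ≤ (1 + R) * jb v := by
        nlinarith [norm_sub_le v w, norm_le_jb v, one_le_jb v]
      have hpow : (1 + R) ^ γ * jb v ^ γ ≤ ‖v - w‖ ^ γ := by
        rw [← Real.mul_rpow (by positivity) hjb.le]
        exact Real.rpow_le_rpow_of_nonpos hz hzle hγ
      rw [inner_A_apply]
      calc κ = ((1 + R) ^ γ * jb v ^ γ) * (δ ^ 2 * ‖x‖ ^ 2) := by ring
        _ ≤ _ := mul_le_mul hpow hwS (by positivity) (by positivity)
    · rw [Set.indicator_of_notMem hw, mul_zero]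
      exact mul_nonneg (hg.nonneg w) (inner_A_apply_nonneg _ _ _)
  have hint := integral_mono ((hg.integrable.indicator hTm).const_mul κ) (hAx.const_inner x) hpt
  rw [integral_const_mul, integral_indicator hTm] at hint
  refine le_trans ?_ hint
  calc 1 / 2 * ((1 + R) ^ γ * δ ^ 2) * jb v ^ γ * ‖x‖ ^ 2 = κ * (1 / 2) := by ring
    _ ≤ _ := mul_le_mul_of_nonneg_left hmass hκ

/-! ### Difference of the velocity fields and the pointwise inequality. -/

/-- A zero of `f` is a minimum, so `∇f` vanishes there; the identity holds everywhere, whatever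
default value `score` takes on `{f = 0}`. -/
theorem IsDensity.smul_score {f : Vel d → ℝ} (hf : IsDensity f) (w : Vel d) :
    f w • score f w = gradient f w := by
  rcases (hf.nonneg w).eq_or_lt with h0 | h0
  · have hmin : IsLocalMin f w := .of_forall fun y => h0 ▸ hf.nonneg y
    rw [← h0, zero_smul, gradient, hmin.fderiv_eq_zero, map_zero]
  · rw [score, gradient, fderiv.log (hf.differentiable w) h0.ne', map_smul, smul_smul,
      mul_inv_cancel₀ h0.ne', one_smul, gradient]

theorem gradient_sub {f g : Vel d → ℝ} {w : Vel d} (hf : DifferentiableAt ℝ f w)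
    (hg : DifferentiableAt ℝ g w) : gradient (f - g) w = gradient f w - gradient g w := by
  rw [gradient, fderiv_sub hf hg, map_sub, gradient, gradient]

theorem relScore_eq_sub {f g : Vel d → ℝ} (hf : IsDensity f) (hg : IsDensity g) {v : Vel d}
    (hfv : 0 < f v) (hgv : 0 < g v) : relScore f g v = score f v - score g v := by
  have h : (fun w => Real.log (f w / g w)) =ᶠ[nhds v]
      (fun w => Real.log (f w)) - fun w => Real.log (g w) := by
    filter_upwards [(hf.differentiable v).continuousAt.eventually_ne hfv.ne',
      (hg.differentiable v).continuousAt.eventually_ne hgv.ne'] with w h1 h2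
    exact Real.log_div h1 h2
  rw [relScore, gradient, h.fderiv_eq, score, score, ← gradient_sub, gradient]
  · exact (hf.differentiable v).log hfv.ne'
  · exact (hg.differentiable v).log hgv.ne'

theorem IsDensity.fieldIntegrand_eq {f : Vel d → ℝ} (hf : IsDensity f) (γ : ℝ) (v w : Vel d) :
    fieldIntegrand γ f v w = f w • A γ (v - w) (score f v) - A γ (v - w) (gradient f w) := by
  rw [fieldIntegrand, map_sub, smul_sub, ← hf.smul_score, map_smul]

theorem ConvAExistsAt.integrable_apply {γ : ℝ} {h : Vel d → ℝ} {v : Vel d}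
    (hA : ConvAExistsAt γ h v) (x : Vel d) : Integrable fun w => h w • A γ (v - w) x :=
  (ContinuousLinearMap.apply ℝ (Vel d) x).integrable_comp
    (φ := fun w => h w • A (d := d) γ (v - w)) hA

/-- The difference of the velocity fields, after integration by parts. -/
theorem U_sub_U {γ : ℝ} {f g : Vel d → ℝ} (hf : IsDensity f) (hg : IsDensity g) {v : Vel d}
    (hUf : Integrable (fieldIntegrand γ f v)) (hUg : Integrable (fieldIntegrand γ g v))
    (hAg : ConvAExistsAt γ g v) (hA : ConvAExistsAt γ (f - g) v) (hB : ConvBExistsAt γ (f - g) v) :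
    U γ f v - U γ g v = -(convA γ (f - g) v (score f v)) -
      convA γ g v (score f v - score g v) + convB γ (f - g) v := by
  have hAf : ConvAExistsAt γ f v := by
    have : Integrable fun w => (f - g) w • A (d := d) γ (v - w) + g w • A (d := d) γ (v - w) :=
      Integrable.add hA hAg
    refine this.congr (.of_forall fun w => ContinuousLinearMap.ext fun x => ?_)
    simp [sub_smul]
  have hff := hAf.integrable_apply (score f v)
  have hgg := hAg.integrable_apply (score g v)
  -- `A ∇f` and `A ∇g` are integrable separately, by subtraction from the field integrands.
  -- Convergence of `b ∗ f` and `b ∗ g` is not available, so only `f - g` is integrated by parts.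
  have hif : Integrable fun w => A γ (v - w) (gradient f w) := by
    refine (hff.sub hUf).congr (.of_forall fun w => ?_)
    simp [hf.fieldIntegrand_eq]
  have ig : Integrable fun w => A γ (v - w) (gradient g w) := by
    refine (hgg.sub hUg).congr (.of_forall fun w => ?_)
    simp [hg.fieldIntegrand_eq]
  have eh : ∀ w, A γ (v - w) (gradient (f - g) w) =
      A γ (v - w) (gradient f w) - A γ (v - w) (gradient g w) := fun w => by
    rw [gradient_sub (hf.differentiable w) (hg.differentiable w), map_sub]
  have key := integral_A_gradient γ (hf.differentiable.sub hg.differentiable) v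
    ((hif.sub ig).congr (.of_forall fun w => (eh w).symm)) hB
  have eB : convB γ (f - g) v = ∫ w, (f - g) w • b γ (v - w) := rfl
  rw [← eB] at key
  simp only [eh] at key
  rw [integral_sub hif ig] at key
  have eA : convA γ (f - g) v (score f v) =
      convA γ f v (score f v) - convA γ g v (score f v) := by
    rw [convA_apply_eq_integral hA, convA_apply_eq_integral hAf, convA_apply_eq_integral hAg,
      ← integral_sub hff (hAg.integrable_apply _)]
    simp [sub_smul]
  rw [U, U, integral_congr_ae (.of_forall (hf.fieldIntegrand_eq γ v)),
    integral_congr_ae (.of_forall (hg.fieldIntegrand_eq γ v)), integral_sub hff hif,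
    integral_sub hgg ig, ← convA_apply_eq_integral hAf, ← convA_apply_eq_integral hAg, eA, map_sub,
    ← key]
  abel

/-- Absorbing the error terms in half of the dissipation. -/
theorem inner_le_neg_half_add {m s σ β : Vel d} {L : Vel d →L[ℝ] Vel d} {κ : ℝ} (hκ : 0 < κ)
    (hm : κ * ‖s‖ ^ 2 ≤ inner ℝ s m) :
    inner ℝ (-(L σ) - m + β) s ≤
      -(1 / 2) * inner ℝ s m + κ⁻¹ * (‖L‖ ^ 2 * ‖σ‖ ^ 2) + κ⁻¹ * ‖β‖ ^ 2 := by
  -- Used twice, for diffusion and drift; the two quarters of `κ‖s‖²` add up to at most half of the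
  -- dissipation.
  have young : ∀ a : ℝ, a * ‖s‖ ≤ κ / 4 * ‖s‖ ^ 2 + κ⁻¹ * a ^ 2 := fun a => by
    have e : κ / 4 * ‖s‖ ^ 2 + κ⁻¹ * a ^ 2 - a * ‖s‖ = κ⁻¹ * (κ / 2 * ‖s‖ - a) ^ 2 := by
      field_simp
      ring
    have : 0 ≤ κ⁻¹ * (κ / 2 * ‖s‖ - a) ^ 2 := by positivity
    linarith
  have h1 : -inner ℝ (L σ) s ≤ ‖L‖ * ‖σ‖ * ‖s‖ :=
    (neg_le_abs _).trans ((abs_real_inner_le_norm _ _).trans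
      (mul_le_mul_of_nonneg_right (L.le_opNorm σ) (norm_nonneg s)))
  have h2 : inner ℝ β s ≤ ‖β‖ * ‖s‖ := real_inner_le_norm _ _
  have y1 := young (‖L‖ * ‖σ‖)
  have y2 := young ‖β‖
  rw [inner_add_left, inner_sub_left, inner_neg_left, real_inner_comm s m]
  rw [mul_pow] at y1
  linarith

theorem diffusionErrorIntegrand_nonneg (γ : ℝ) {f : Vel d → ℝ} (hf : IsDensity f) (g : Vel d → ℝ)
    (v : Vel d) : 0 ≤ diffusionErrorIntegrand γ f g v := by
  have h1 := hf.nonneg v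
  have h2 : 0 ≤ jb v := Real.sqrt_nonneg _
  unfold diffusionErrorIntegrand
  positivity

theorem driftErrorIntegrand_nonneg (γ : ℝ) {f : Vel d → ℝ} (hf : IsDensity f) (g : Vel d → ℝ)
    (v : Vel d) : 0 ≤ driftErrorIntegrand γ f g v := by
  have h1 := hf.nonneg v
  have h2 : 0 ≤ jb v := Real.sqrt_nonneg _
  unfold driftErrorIntegrand
  positivity

/-- In dimension at most one `x` and `z` are parallel. This settles the dimensions in which
coercivity fails. -/
theorem A_eq_zero (hd : d < 2) (γ : ℝ) (z : Vel d) : A γ z = 0 := by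
  ext1 x
  rw [A_apply]
  interval_cases d
  · exact Subsingleton.elim _ _
  · have : ‖z‖ ^ 2 • x - inner ℝ z x • z = 0 := by
      ext i
      rw [Subsingleton.elim i 0]
      simp [EuclideanSpace.real_norm_sq_eq, PiLp.inner_apply]
      ring
    rw [this, smul_zero, zero_apply]

/-- The pointwise form of the entropy dissipation inequality. -/
theorem exists_lhsIntegrand_le (d : ℕ) {γ : ℝ} (hγ : γ ≤ 0) (E H : ℝ) :
    ∃ C : ℝ, 0 < C ∧ ∀ f g : Vel d → ℝ, IsDensity f → IsDensity g → energy g ≤ E →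
      entropy g ≤ H → LhsFinite γ f g → (∀ᵐ v, 0 < f v → ConvAExistsAt γ g v) →
      (∀ᵐ v, 0 < f v → ConvAExistsAt γ (f - g) v) →
      (∀ᵐ v, 0 < f v → ConvBExistsAt γ (f - g) v) →
      ∀ᵐ v, lhsIntegrand γ f g v ≤ -(1 / 2) * dissipationIntegrand γ f g v +
        C * diffusionErrorIntegrand γ f g v + C * driftErrorIntegrand γ f g v := by
  rcases lt_or_ge d 2 with hd | hd
  · refine ⟨1, one_pos, fun f g hf hg _ _ _ _ _ _ => .of_forall fun v => ?_⟩
    have hU : ∀ h : Vel d → ℝ, U γ h v = 0 := fun h => by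
      simp [U, fieldIntegrand, A_eq_zero hd]
    have hA : convA γ g v = 0 := by simp [convA, convolution_def, A_eq_zero hd]
    have h1 := diffusionErrorIntegrand_nonneg γ hf g v
    have h2 := driftErrorIntegrand_nonneg γ hf g v
    have h3 : lhsIntegrand γ f g v = 0 := by simp [lhsIntegrand, hU]
    have h4 : dissipationIntegrand γ f g v = 0 := by simp [dissipationIntegrand, quadNormSq, hA]
    linarith
  obtain ⟨c, hc, hcoer⟩ := exists_le_quadNormSq_convA hd hγ E H
  refine ⟨c⁻¹, inv_pos.2 hc, fun f g hf hg hE hH hL hAg hA hB => ?_⟩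
  filter_upwards [hL.pos, hL.field_left, hL.field_right, hAg, hA, hB]
    with v hpos hUf hUg hAg hA hB
  rcases (hf.nonneg v).eq_or_lt with h0 | h0
  · simp [lhsIntegrand, dissipationIntegrand, diffusionErrorIntegrand, driftErrorIntegrand, ← h0]
  have hrel := relScore_eq_sub hf hg h0 (hpos h0)
  have hjb : 0 < jb v := one_pos.trans_le (one_le_jb v)
  have key := inner_le_neg_half_add (κ := c * jb v ^ γ) (σ := score f v)
    (L := convA γ (f - g) v) (β := convB γ (f - g) v) (by positivity)
    (hcoer g hg hE hH v (hAg h0) (relScore f g v))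
  nth_rw 1 [hrel] at key
  rw [← U_sub_U hf hg (hUf h0) (hUg h0) (hAg h0) (hA h0) (hB h0), mul_inv,
    ← Real.rpow_neg hjb.le] at key
  have := mul_le_mul_of_nonneg_left key h0.le
  rw [lhsIntegrand, dissipationIntegrand, diffusionErrorIntegrand, driftErrorIntegrand, quadNormSq]
  refine this.trans (le_of_eq ?_)
  ring

/-! ### Convolution estimates for the Coulomb kernel. -/

theorem lintegral_mul_sq_le {α : Type*} [MeasurableSpace α] {μ : Measure α} {f g : α → ℝ≥0∞}
    (hf : AEMeasurable f μ) (hg : AEMeasurable g μ) :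
    (∫⁻ x, f x * g x ∂μ) ^ 2 ≤ (∫⁻ x, f x ^ 2 ∂μ) * ∫⁻ x, g x ^ 2 ∂μ := by
  have h := ENNReal.lintegral_mul_le_Lp_mul_Lq μ Real.HolderConjugate.two_two hf hg
  simp only [Pi.mul_apply, ENNReal.rpow_ofNat] at h
  calc _ ≤ ((∫⁻ x, f x ^ 2 ∂μ) ^ (1 / 2 : ℝ) * (∫⁻ x, g x ^ 2 ∂μ) ^ (1 / 2 : ℝ)) ^ 2 := by gcongr
    _ = _ := by
      rw [mul_pow, ← ENNReal.rpow_mul_natCast, ← ENNReal.rpow_mul_natCast]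
      norm_num

/-- The truncated power `|z|^{-2/3} 1_{|z| < 1}`, whose powers dominate the singular parts of the
Coulomb kernels. -/
noncomputable def truncPow (z : Vel 3) : ℝ := if ‖z‖ < 1 then ‖z‖ ^ (-(2 / 3) : ℝ) else 0

theorem truncPow_nonneg (z : Vel 3) : 0 ≤ truncPow z := by
  unfold truncPow
  split_ifs <;> positivity

/-- Avoiding the interval `(0, 1)` makes the powers of `truncPow` increase with the exponent. At the
origin the value is `0`, by the convention for `0` to a negative power. -/
theorem truncPow_eq_zero_or_one_le (z : Vel 3) : truncPow z = 0 ∨ 1 ≤ truncPow z := by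
  unfold truncPow
  split_ifs with h
  · rcases (norm_nonneg z).eq_or_lt with h0 | h0
    · left
      rw [← h0, Real.zero_rpow (by norm_num)]
    · exact .inr (Real.one_le_rpow_of_pos_of_le_one_of_nonpos h0 h.le (by norm_num))
  · exact .inl rfl

theorem truncPow_pow_le {m n : ℕ} (hm : m ≠ 0) (hmn : m ≤ n) (z : Vel 3) :
    truncPow z ^ m ≤ truncPow z ^ n := by
  rcases truncPow_eq_zero_or_one_le z with h | h
  · rw [h, zero_pow hm]
    exact pow_nonneg le_rfl n
  · exact pow_le_pow_right₀ h hmn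

theorem measurable_truncPow : Measurable truncPow := by
  unfold truncPow
  exact Measurable.ite (measurableSet_lt measurable_norm measurable_const)
    (measurable_norm.pow_const _) measurable_const

/-- In polar coordinates the integrand is `r² r^{-8/3} = r^{-2/3}`. The exponent `2/3` is chosen so
that the cube is the `|z|^{-2}` of `b` while the fourth power, met in Cauchy-Schwarz, stays
integrable. -/
theorem integrable_truncPow_pow_four : Integrable fun z => truncPow z ^ 4 := by
  have h := (integrable_fun_norm_addHaar (volume : Measure (Vel 3))
    (f := fun y : ℝ => (if y < 1 then y ^ (-(2 / 3) : ℝ) else 0) ^ 4)).2 ?_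
  · exact h
  have h1 : IntegrableOn (fun y : ℝ => y ^ (-(2 / 3) : ℝ)) (Set.Ioo 0 1) :=
    (intervalIntegral.integrableOn_Ioo_rpow_iff one_pos).2 (by norm_num)
  have h2 : Integrable ((Set.Ioo (0 : ℝ) 1).indicator fun y : ℝ => y ^ (-(2 / 3) : ℝ)) :=
    (integrable_indicator_iff measurableSet_Ioo).2 h1
  refine h2.integrableOn.congr_fun (fun y hy => ?_) measurableSet_Ioi
  have hy0 : 0 < y := hy
  by_cases hy1 : y < 1
  · rw [Set.indicator_of_mem (show y ∈ Set.Ioo (0 : ℝ) 1 from ⟨hy0, hy1⟩)]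
    simp only [hy1, if_true, finrank_euclideanSpace_fin, smul_eq_mul]
    rw [← Real.rpow_mul_natCast hy0.le, ← Real.rpow_natCast, ← Real.rpow_add hy0]
    norm_num
  · rw [Set.indicator_of_notMem fun h => hy1 h.2]
    simp [hy1]

theorem norm_A_coulomb_le (z : Vel 3) : ‖A (-3) z‖ ≤ 2 * (truncPow z ^ 2 + 1) := by
  rcases eq_or_ne z 0 with rfl | hz
  · have : A (-3) (0 : Vel 3) = 0 := ContinuousLinearMap.ext fun x => by simp [A_apply]
    rw [this, norm_zero]
    positivity
  have hz0 : 0 < ‖z‖ := norm_pos_iff.2 hz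
  have h1 : ‖A (-3) z‖ ≤ 2 * ‖z‖ ^ (-1 : ℝ) := by
    refine ContinuousLinearMap.opNorm_le_bound _ (by positivity) fun x => ?_
    have h2 : ‖‖z‖ ^ 2 • x - inner ℝ z x • z‖ ≤ 2 * ‖z‖ ^ 2 * ‖x‖ := by
      refine (norm_sub_le _ _).trans ?_
      rw [norm_smul, norm_smul, Real.norm_of_nonneg (sq_nonneg _)]
      nlinarith [norm_inner_le_norm (𝕜 := ℝ) z x]
    rw [A_apply, norm_smul, Real.norm_of_nonneg (by positivity)]
    calc _ ≤ ‖z‖ ^ (-3 : ℝ) * (2 * ‖z‖ ^ 2 * ‖x‖) := by gcongr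
      _ = 2 * (‖z‖ ^ (-3 : ℝ) * ‖z‖ ^ (2 : ℝ)) * ‖x‖ := by
        rw [Real.rpow_two]
        ring
      _ = _ := by
        rw [← Real.rpow_add hz0]
        norm_num
  refine h1.trans (mul_le_mul_of_nonneg_left ?_ zero_le_two)
  unfold truncPow
  split_ifs with h
  · rw [← Real.rpow_mul_natCast hz0.le]
    have := Real.rpow_le_rpow_of_exponent_ge hz0 h.le
      (show (-(2 / 3) * (2 : ℕ) : ℝ) ≤ -1 by norm_num)
    linarith
  · have := Real.rpow_le_one_of_one_le_of_nonpos (not_lt.1 h) (show (-1 : ℝ) ≤ 0 by norm_num)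
    simpa using this

theorem norm_b_coulomb_le (z : Vel 3) : ‖b (-3) z‖ ≤ 2 * (truncPow z ^ 3 + 1) := by
  rcases eq_or_ne z 0 with rfl | hz
  · have := truncPow_nonneg 0
    simp only [b, smul_zero, norm_zero]
    positivity
  have hz0 : 0 < ‖z‖ := norm_pos_iff.2 hz
  have h1 : ‖b (-3) z‖ = 2 * ‖z‖ ^ (-2 : ℝ) := by
    rw [b, norm_smul, norm_mul, Real.norm_of_nonneg (by positivity : 0 ≤ ‖z‖ ^ (-3 : ℝ)), mul_assoc]
    nth_rw 2 [← Real.rpow_one ‖z‖]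
    rw [← Real.rpow_add hz0]
    norm_num
  rw [h1]
  refine mul_le_mul_of_nonneg_left ?_ zero_le_two
  unfold truncPow
  split_ifs with h
  · rw [← Real.rpow_mul_natCast hz0.le]
    norm_num
  · have := Real.rpow_le_one_of_one_le_of_nonpos (not_lt.1 h) (show (-2 : ℝ) ≤ 0 by norm_num)
    simpa using this

theorem aestronglyMeasurable_A {d : ℕ} (γ : ℝ) : AEStronglyMeasurable (A (d := d) γ) := by
  have h1 : Continuous fun z : Vel d =>
      (‖z‖ ^ 2) • ContinuousLinearMap.id ℝ (Vel d) - (innerSL ℝ z).smulRight z := by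
    have : Continuous fun z : Vel d => (innerSL ℝ z).smulRight z :=
      ((ContinuousLinearMap.smulRightL ℝ (Vel d) (Vel d)).continuous₂).comp
        ((innerSL ℝ (E := Vel d)).continuous.prodMk continuous_id)
    fun_prop
  exact (measurable_norm.pow_const γ).aestronglyMeasurable.smul h1.aestronglyMeasurable

theorem aestronglyMeasurable_b {d : ℕ} (γ : ℝ) : AEStronglyMeasurable (b (d := d) γ) :=
  ((measurable_norm.pow_const γ).const_mul _).aestronglyMeasurable.smul
    continuous_id.aestronglyMeasurable

/-- Convolution of a bounded integrable function with a kernel of Coulomb type converges. -/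
theorem convolutionExistsAt_of_norm_le_truncPow {E : Type*} [NormedAddCommGroup E] [NormedSpace ℝ E]
    {h : Vel 3 → ℝ} (h1 : Integrable h) (h_top : MemLp h ∞) {T : Vel 3 → E}
    (hT : AEStronglyMeasurable T) {m : ℕ} (hm0 : m ≠ 0) (hm : m ≤ 4)
    (hTle : ∀ z, ‖T z‖ ≤ 2 * (truncPow z ^ m + 1)) (v : Vel 3) :
    ConvolutionExistsAt h T v (ContinuousLinearMap.lsmul ℝ ℝ) volume := by
  have hK : Integrable fun w => truncPow (v - w) ^ 4 := integrable_truncPow_pow_four.comp_sub_left v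
  have hTv : AEStronglyMeasurable fun w => T (v - w) :=
    hT.comp_measurePreserving (Measure.measurePreserving_sub_left volume v)
  refine Integrable.mono' ((hK.const_mul (2 * lpNorm h ∞ volume)).add (h1.norm.const_mul 2))
    (h1.aestronglyMeasurable.smul hTv) ?_
  filter_upwards [ae_le_lpNorm_exponent_top h_top] with w hw
  have e := hTle (v - w)
  have e' := truncPow_pow_le hm0 hm (v - w)
  have p := pow_nonneg (truncPow_nonneg (v - w)) m
  have p' : 0 ≤ lpNorm h ∞ volume := lpNorm_nonneg
  simp only [ContinuousLinearMap.lsmul_apply, norm_smul, Pi.add_apply]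
  calc ‖h w‖ * ‖T (v - w)‖ ≤ ‖h w‖ * (2 * (truncPow (v - w) ^ m + 1)) := by gcongr
    _ = 2 * (‖h w‖ * truncPow (v - w) ^ m) + 2 * ‖h w‖ := by ring
    _ ≤ 2 * (lpNorm h ∞ volume * truncPow (v - w) ^ 4) + 2 * ‖h w‖ := by gcongr
    _ = _ := by ring

theorem convAExistsAt_coulomb {h : Vel 3 → ℝ} (h1 : Integrable h) (h_top : MemLp h ∞) (v : Vel 3) :
    ConvAExistsAt (-3) h v :=
  convolutionExistsAt_of_norm_le_truncPow h1 h_top (aestronglyMeasurable_A _) two_ne_zero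
    (by norm_num) norm_A_coulomb_le v

theorem convBExistsAt_coulomb {h : Vel 3 → ℝ} (h1 : Integrable h) (h_top : MemLp h ∞) (v : Vel 3) :
    ConvBExistsAt (-3) h v :=
  convolutionExistsAt_of_norm_le_truncPow h1 h_top (aestronglyMeasurable_b _) three_ne_zero
    (by norm_num) norm_b_coulomb_le v

/-- `truncPow` with values in the extended nonnegative reals. -/
noncomputable def truncPowE (z : Vel 3) : ℝ≥0∞ := ENNReal.ofReal (truncPow z)

theorem measurable_truncPowE : Measurable truncPowE := measurable_truncPow.ennreal_ofReal

theorem exists_lintegral_truncPowE_le :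
    ∃ k : ℝ, 0 < k ∧ ∀ v, ∫⁻ w, truncPowE (v - w) ^ 4 ≤ ENNReal.ofReal k ^ 2 := by
  -- The bound is written as a square because its square root `κ` appears too; the `1` only ensures
  -- positivity.
  refine ⟨Real.sqrt (∫ z, truncPow z ^ 4) + 1, by positivity, fun v => ?_⟩
  have h0 : 0 ≤ ∫ z, truncPow z ^ 4 :=
    integral_nonneg fun z => pow_nonneg (truncPow_nonneg z) 4
  rw [lintegral_sub_left_eq_self (μ := volume) (fun z => truncPowE z ^ 4) v,
    ← ENNReal.ofReal_pow (by positivity)]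
  simp only [truncPowE, ← ENNReal.ofReal_pow (truncPow_nonneg _)]
  rw [← ofReal_integral_eq_lintegral_ofReal integrable_truncPow_pow_four
    (.of_forall fun z => pow_nonneg (truncPow_nonneg z) 4)]
  refine ENNReal.ofReal_le_ofReal ?_
  nlinarith [Real.sq_sqrt h0, Real.sqrt_nonneg (∫ z, truncPow z ^ 4)]

theorem enorm_convolution_le {E : Type*} [NormedAddCommGroup E] [NormedSpace ℝ E]
    {h : Vel 3 → ℝ} (hh : Measurable h) {T : Vel 3 → E} {m : ℕ}
    (hTle : ∀ z, ‖T z‖ ≤ 2 * (truncPow z ^ m + 1)) (v : Vel 3) :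
    ‖(h ⋆[ContinuousLinearMap.lsmul ℝ ℝ, volume] T) v‖ₑ ^ 2 ≤
      8 * ((∫⁻ w, ‖h w‖ₑ * truncPowE (v - w) ^ m) ^ 2 + (∫⁻ w, ‖h w‖ₑ) ^ 2) := by
  have h1 : ‖(h ⋆[ContinuousLinearMap.lsmul ℝ ℝ, volume] T) v‖ₑ ≤
      2 * ((∫⁻ w, ‖h w‖ₑ * truncPowE (v - w) ^ m) + ∫⁻ w, ‖h w‖ₑ) := by
    rw [convolution_def]
    refine (enorm_integral_le_lintegral_enorm _).trans ?_
    rw [← lintegral_add_right _ hh.enorm, ← lintegral_const_mul' _ _ ENNReal.ofNat_ne_top]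
    refine lintegral_mono fun w => ?_
    have e : ‖T (v - w)‖ₑ ≤ 2 * (truncPowE (v - w) ^ m + 1) := by
      have := ENNReal.ofReal_le_ofReal (hTle (v - w))
      rw [ofReal_norm, ENNReal.ofReal_mul zero_le_two,
        ENNReal.ofReal_add (pow_nonneg (truncPow_nonneg _) m) zero_le_one,
        ENNReal.ofReal_pow (truncPow_nonneg _)] at this
      simpa [truncPowE] using this
    simp only [ContinuousLinearMap.lsmul_apply, enorm_smul]
    calc _ ≤ ‖h w‖ₑ * (2 * (truncPowE (v - w) ^ m + 1)) := by gcongr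
      _ = _ := by ring
  calc _ ≤ (2 * ((∫⁻ w, ‖h w‖ₑ * truncPowE (v - w) ^ m) + ∫⁻ w, ‖h w‖ₑ)) ^ 2 := by gcongr
    _ = 4 * ((∫⁻ w, ‖h w‖ₑ * truncPowE (v - w) ^ m) + ∫⁻ w, ‖h w‖ₑ) ^ 2 := by ring
    _ ≤ 4 * (2 * ((∫⁻ w, ‖h w‖ₑ * truncPowE (v - w) ^ m) ^ 2 + (∫⁻ w, ‖h w‖ₑ) ^ 2)) := by
      gcongr
      have := ENNReal.rpow_add_le_mul_rpow_add_rpow (∫⁻ w, ‖h w‖ₑ * truncPowE (v - w) ^ m)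
        (∫⁻ w, ‖h w‖ₑ) (p := 2) (by norm_num)
      norm_num at this
      simpa only [ENNReal.rpow_ofNat] using this
    _ = _ := by ring

theorem measurable_truncPowE_sub (v : Vel 3) : Measurable fun w => truncPowE (v - w) :=
  measurable_truncPowE.comp (measurable_const.sub measurable_id)

/-- The sup bound on `A ∗ h` for the Coulomb kernel. -/
theorem enorm_convA_coulomb_le {h : Vel 3 → ℝ} (hh : Measurable h) {κ : ℝ≥0∞}
    (hκ : ∀ v, ∫⁻ w, truncPowE (v - w) ^ 4 ≤ κ ^ 2) (v : Vel 3) :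
    ‖convA (-3) h v‖ₑ ^ 2 ≤ 8 * ((∫⁻ w, ‖h w‖ₑ ^ 2) * κ ^ 2 + (∫⁻ w, ‖h w‖ₑ) ^ 2) := by
  refine (enorm_convolution_le hh norm_A_coulomb_le v).trans ?_
  gcongr
  refine (lintegral_mul_sq_le hh.enorm.aemeasurable
    ((measurable_truncPowE_sub v).pow_const 2).aemeasurable).trans ?_
  gcongr
  simpa only [← pow_mul] using hκ v

/-- The weighted `L²` bound on `b ∗ h` for the Coulomb kernel. -/
theorem lintegral_mul_enorm_convB_coulomb_le {h : Vel 3 → ℝ} (hh : Measurable h) {κ : ℝ≥0∞}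
    (hκ : ∀ v, ∫⁻ w, truncPowE (v - w) ^ 4 ≤ κ ^ 2) {F : Vel 3 → ℝ} (hF : Measurable F) :
    ∫⁻ v, ‖F v‖ₑ * ‖convB (-3) h v‖ₑ ^ 2 ≤
      8 * (κ ^ 3 * (∫⁻ w, ‖h w‖ₑ ^ 2) * eLpNorm F 2 volume +
        (∫⁻ w, ‖h w‖ₑ) ^ 2 * eLpNorm F 1 volume) := by
  have hm : Measurable fun p : Vel 3 × Vel 3 => truncPowE (p.1 - p.2) :=
    measurable_truncPowE.comp (measurable_fst.sub measurable_snd)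
  have h1 : ∀ v, ‖convB (-3) h v‖ₑ ^ 2 ≤
      8 * (κ ^ 2 * (∫⁻ w, truncPowE (v - w) ^ 2 * ‖h w‖ₑ ^ 2) + (∫⁻ w, ‖h w‖ₑ) ^ 2) := fun v => by
    refine (enorm_convolution_le hh norm_b_coulomb_le v).trans ?_
    gcongr
    -- Splitting the cube as `2 + 1` puts the integrable fourth power in one factor of
    -- Cauchy-Schwarz and leaves a square against `|h|²` in the other.
    have e : ∀ w, ‖h w‖ₑ * truncPowE (v - w) ^ 3 =
        truncPowE (v - w) ^ 2 * (truncPowE (v - w) * ‖h w‖ₑ) := fun w => by ring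
    simp only [e]
    refine (lintegral_mul_sq_le ((measurable_truncPowE_sub v).pow_const 2).aemeasurable
      ((measurable_truncPowE_sub v).mul hh.enorm).aemeasurable).trans ?_
    simp only [Pi.mul_apply, mul_pow, ← pow_mul]
    gcongr
    exact hκ v
  -- After Tonelli the remaining square is paired with `F ∈ L²`, giving the fourth power again: `κ²
  -- · κ = κ³` in total.
  have h2 : ∀ w, ∫⁻ v, ‖F v‖ₑ * truncPowE (v - w) ^ 2 ≤ κ * eLpNorm F 2 volume := fun w => by
    have e : ∀ v, truncPowE (v - w) = truncPowE (w - v) := fun v => by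
      simp [truncPowE, truncPow, norm_sub_rev]
    have e2 : eLpNorm F 2 volume ^ 2 = ∫⁻ v, ‖F v‖ₑ ^ 2 := by
      have := eLpNorm_nnreal_pow_eq_lintegral (f := F) (μ := volume) (p := 2) (by norm_num)
      simpa using this
    simp only [e]
    rw [← ENNReal.pow_le_pow_left_iff two_ne_zero, mul_pow, e2]
    refine (lintegral_mul_sq_le hF.enorm.aemeasurable
      ((measurable_truncPowE_sub w).pow_const 2).aemeasurable).trans ?_
    rw [mul_comm]
    gcongr
    simpa only [← pow_mul] using hκ w
  have h3 : ∫⁻ v, ‖F v‖ₑ * (∫⁻ w, truncPowE (v - w) ^ 2 * ‖h w‖ₑ ^ 2) ≤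
      (∫⁻ w, ‖h w‖ₑ ^ 2) * (κ * eLpNorm F 2 volume) := by
    have e : ∀ v, ‖F v‖ₑ * (∫⁻ w, truncPowE (v - w) ^ 2 * ‖h w‖ₑ ^ 2) =
        ∫⁻ w, ‖F v‖ₑ * (truncPowE (v - w) ^ 2 * ‖h w‖ₑ ^ 2) := fun v =>
      (lintegral_const_mul' _ _ enorm_ne_top).symm
    simp only [e]
    rw [lintegral_lintegral_swap (by
      exact ((hF.enorm.comp measurable_fst).mul ((hm.pow_const 2).mul
        ((hh.enorm.comp measurable_snd).pow_const 2))).aemeasurable),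
      ← lintegral_mul_const _ (hh.enorm.pow_const 2)]
    refine lintegral_mono fun w => ?_
    have e' : ∀ v, ‖F v‖ₑ * (truncPowE (v - w) ^ 2 * ‖h w‖ₑ ^ 2) =
        ‖h w‖ₑ ^ 2 * (‖F v‖ₑ * truncPowE (v - w) ^ 2) := fun v => by ring
    simp only [e']
    rw [lintegral_const_mul' _ _ (ENNReal.pow_ne_top enorm_ne_top)]
    gcongr
    exact h2 w
  have hG : Measurable fun v => ∫⁻ w, truncPowE (v - w) ^ 2 * ‖h w‖ₑ ^ 2 :=
    ((hm.pow_const 2).mul ((hh.enorm.comp measurable_snd).pow_const 2)).lintegral_prod_right'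
  calc ∫⁻ v, ‖F v‖ₑ * ‖convB (-3) h v‖ₑ ^ 2
      ≤ ∫⁻ v, (8 * κ ^ 2 * (‖F v‖ₑ * (∫⁻ w, truncPowE (v - w) ^ 2 * ‖h w‖ₑ ^ 2)) +
          8 * (∫⁻ w, ‖h w‖ₑ) ^ 2 * ‖F v‖ₑ) := by
        refine lintegral_mono fun v => (mul_le_mul_right (h1 v) _).trans (le_of_eq ?_)
        ring
    _ = 8 * κ ^ 2 * (∫⁻ v, ‖F v‖ₑ * (∫⁻ w, truncPowE (v - w) ^ 2 * ‖h w‖ₑ ^ 2)) +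
          8 * (∫⁻ w, ‖h w‖ₑ) ^ 2 * ∫⁻ v, ‖F v‖ₑ := by
        rw [lintegral_add_right _ (hF.enorm.const_mul _), lintegral_const_mul _ hF.enorm,
          lintegral_const_mul _ (by exact hF.enorm.mul hG)]
    _ ≤ 8 * κ ^ 2 * ((∫⁻ w, ‖h w‖ₑ ^ 2) * (κ * eLpNorm F 2 volume)) +
          8 * (∫⁻ w, ‖h w‖ₑ) ^ 2 * ∫⁻ v, ‖F v‖ₑ := by gcongr
    _ = _ := by
        rw [eLpNorm_one_eq_lintegral_enorm]
        ring

/-! ### Control of `f - g` by the relative entropy. -/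

/-- With `s = a²`, `t = b²`, the bound `log(b/a) ≤ b/a - 1` gives `(a - b)² ≤ s log(s/t) - s + t`,
and `(a + b)² ≤ 2(a² + b²)` does the rest. -/
theorem sq_sub_div_add_le {s t : ℝ} (hs : 0 ≤ s) (ht : 0 ≤ t) (hst : 0 < s → 0 < t) :
    (s - t) ^ 2 / (s + t) ≤ 2 * (s * Real.log (s / t) - s + t) := by
  rcases hs.eq_or_lt with rfl | hs
  · rcases ht.eq_or_lt with rfl | ht
    · simp
    · rw [zero_add, div_le_iff₀ ht]
      nlinarith
  have ht := hst hs
  obtain ⟨a, ha, rfl⟩ : ∃ a, 0 < a ∧ s = a ^ 2 :=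
    ⟨Real.sqrt s, Real.sqrt_pos.2 hs, (Real.sq_sqrt hs.le).symm⟩
  obtain ⟨b, hb, rfl⟩ : ∃ b, 0 < b ∧ t = b ^ 2 :=
    ⟨Real.sqrt t, Real.sqrt_pos.2 ht, (Real.sq_sqrt ht.le).symm⟩
  have h1 : Real.log (a ^ 2 / b ^ 2) = -(2 * Real.log (b / a)) := by
    rw [← div_pow, Real.log_pow, ← inv_div b a, Real.log_inv]
    push_cast
    ring
  have h2 : Real.log (b / a) ≤ b / a - 1 := Real.log_le_sub_one_of_pos (by positivity)
  have h3 : a ^ 2 * (b / a - 1) = a * b - a ^ 2 := by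
    field_simp
  have h4 : a ^ 2 * Real.log (b / a) ≤ a * b - a ^ 2 := by
    rw [← h3]
    gcongr
  have h5 : (a - b) ^ 2 ≤ a ^ 2 * Real.log (a ^ 2 / b ^ 2) - a ^ 2 + b ^ 2 := by
    rw [h1]
    nlinarith
  rw [div_le_iff₀ (by positivity)]
  have h6 : (a ^ 2 - b ^ 2) ^ 2 ≤ 2 * (a - b) ^ 2 * (a ^ 2 + b ^ 2) := by
    nlinarith [mul_nonneg (sq_nonneg (a - b)) (sq_nonneg (a - b))]
  refine h6.trans ?_
  gcongr

theorem IsDensity.measurable {f : Vel d → ℝ} (hf : IsDensity f) : Measurable f :=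
  hf.differentiable.continuous.measurable

/-- The triangular discrimination is controlled by the relative entropy. -/
theorem lintegral_sq_sub_div_add_le {f g : Vel d → ℝ} (hf : IsDensity f) (hg : IsDensity g)
    (hpos : ∀ᵐ v, 0 < f v → 0 < g v) (hkl : Integrable fun v => f v * Real.log (f v / g v)) :
    0 ≤ KL f g ∧ ∫⁻ v, ENNReal.ofReal ((f v - g v) ^ 2 / (f v + g v)) ≤
      ENNReal.ofReal (2 * KL f g) := by
  -- Both densities have mass one, so adding `g - f` leaves the integral unchanged while making the
  -- integrand nonnegative almost everywhere.
  have hi : Integrable fun v => 2 * (f v * Real.log (f v / g v) - f v + g v) :=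
    ((hkl.sub hf.integrable).add hg.integrable).const_mul 2
  have hval : ∫ v, 2 * (f v * Real.log (f v / g v) - f v + g v) = 2 * KL f g := by
    rw [integral_const_mul, integral_add (by exact hkl.sub hf.integrable) hg.integrable,
      integral_sub hkl hf.integrable, hf.integral_eq_one, hg.integral_eq_one, KL]
    ring
  have hle : ∀ᵐ v, (f v - g v) ^ 2 / (f v + g v) ≤
      2 * (f v * Real.log (f v / g v) - f v + g v) := by
    filter_upwards [hpos] with v hv
    exact sq_sub_div_add_le (hf.nonneg v) (hg.nonneg v) hv
  have h0 : ∀ᵐ v, 0 ≤ 2 * (f v * Real.log (f v / g v) - f v + g v) := by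
    filter_upwards [hle] with v hv
    exact (div_nonneg (sq_nonneg _) (add_nonneg (hf.nonneg v) (hg.nonneg v))).trans hv
  constructor
  · have := integral_nonneg_of_ae h0
    linarith
  · rw [← hval, ofReal_integral_eq_lintegral_ofReal hi h0]
    refine lintegral_mono_ae ?_
    filter_upwards [hle] with v hv
    exact ENNReal.ofReal_le_ofReal hv

theorem enorm_sub_eq {s t : ℝ} (hs : 0 ≤ s) (ht : 0 ≤ t) :
    ‖s - t‖ₑ ^ 2 = ENNReal.ofReal ((s - t) ^ 2 / (s + t)) * ENNReal.ofReal (s + t) := by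
  rw [← ENNReal.ofReal_mul (by positivity), Real.enorm_eq_ofReal_abs,
    ← ENNReal.ofReal_pow (abs_nonneg _), sq_abs]
  congr 1
  rcases (add_nonneg hs ht).eq_or_lt with h | h
  · have h1 : s = 0 := by linarith
    have h2 : t = 0 := by linarith
    simp [h1, h2]
  · rw [div_mul_cancel₀ _ h.ne']

/-- A form of Pinsker's inequality. -/
theorem lintegral_enorm_sub_sq_le {f g : Vel d → ℝ} (hf : IsDensity f) (hg : IsDensity g)
    (hpos : ∀ᵐ v, 0 < f v → 0 < g v) (hkl : Integrable fun v => f v * Real.log (f v / g v)) :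
    (∫⁻ v, ‖(f - g) v‖ₑ) ^ 2 ≤ ENNReal.ofReal (4 * KL f g) := by
  have hm1 : Measurable fun v => ENNReal.ofReal ((f v - g v) ^ 2 / (f v + g v)) :=
    (((hf.measurable.sub hg.measurable).pow_const 2).div
      (hf.measurable.add hg.measurable)).ennreal_ofReal
  have hm2 : Measurable fun v => ENNReal.ofReal (f v + g v) :=
    (hf.measurable.add hg.measurable).ennreal_ofReal
  have hsq : ∀ x : ℝ≥0∞, (x ^ (1 / 2 : ℝ)) ^ 2 = x := fun x => by
    rw [← ENNReal.rpow_mul_natCast]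
    norm_num
  -- Cauchy-Schwarz for this factorization, with `∫ (f + g) = 2`.
  have e : ∀ v, ‖(f - g) v‖ₑ = ENNReal.ofReal ((f v - g v) ^ 2 / (f v + g v)) ^ (1 / 2 : ℝ) *
      ENNReal.ofReal (f v + g v) ^ (1 / 2 : ℝ) := fun v => by
    refine (ENNReal.pow_right_strictMono two_ne_zero).injective ?_
    simp only [mul_pow, hsq]
    exact enorm_sub_eq (hf.nonneg v) (hg.nonneg v)
  simp only [e]
  refine (lintegral_mul_sq_le (hm1.pow_const _).aemeasurable
    (hm2.pow_const _).aemeasurable).trans ?_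
  simp only [hsq]
  obtain ⟨hK, hle⟩ := lintegral_sq_sub_div_add_le hf hg hpos hkl
  have h2 : ∫⁻ v, ENNReal.ofReal (f v + g v) = ENNReal.ofReal 2 := by
    rw [← ofReal_integral_eq_lintegral_ofReal (by exact hf.integrable.add hg.integrable)
      (.of_forall fun v => add_nonneg (hf.nonneg v) (hg.nonneg v)),
      integral_add hf.integrable hg.integrable, hf.integral_eq_one, hg.integral_eq_one]
    norm_num
  rw [h2]
  calc _ ≤ ENNReal.ofReal (2 * KL f g) * ENNReal.ofReal 2 := by gcongr
    _ = _ := by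
      rw [← ENNReal.ofReal_mul (by positivity)]
      congr 1
      ring

/-- Same weight `f + g` as for the `L¹` norm, now bounded by the sup norms instead of integrated. -/
theorem lintegral_enorm_sub_pow_two_le {f g : Vel d → ℝ} (hf : IsDensity f) (hg : IsDensity g)
    (hpos : ∀ᵐ v, 0 < f v → 0 < g v) (hkl : Integrable fun v => f v * Real.log (f v / g v))
    (hf_top : MemLp f ∞) (hg_top : MemLp g ∞) :
    ∫⁻ v, ‖(f - g) v‖ₑ ^ 2 ≤
      ENNReal.ofReal (2 * (lpNorm f ∞ volume + lpNorm g ∞ volume) * KL f g) := by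
  obtain ⟨hK, hle⟩ := lintegral_sq_sub_div_add_le hf hg hpos hkl
  have hM : 0 ≤ lpNorm f ∞ volume + lpNorm g ∞ volume := add_nonneg lpNorm_nonneg lpNorm_nonneg
  calc ∫⁻ v, ‖(f - g) v‖ₑ ^ 2
      ≤ ∫⁻ v, ENNReal.ofReal ((f v - g v) ^ 2 / (f v + g v)) *
        ENNReal.ofReal (lpNorm f ∞ volume + lpNorm g ∞ volume) := by
        refine lintegral_mono_ae ?_
        filter_upwards [ae_le_lpNorm_exponent_top hf_top, ae_le_lpNorm_exponent_top hg_top]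
          with v h1 h2
        rw [Pi.sub_apply, enorm_sub_eq (hf.nonneg v) (hg.nonneg v)]
        gcongr
        · exact (le_abs_self _).trans h1
        · exact (le_abs_self _).trans h2
    _ ≤ ENNReal.ofReal (2 * KL f g) *
        ENNReal.ofReal (lpNorm f ∞ volume + lpNorm g ∞ volume) := by
        rw [lintegral_mul_const' _ _ ENNReal.ofReal_ne_top]
        gcongr
    _ = _ := by
        rw [← ENNReal.ofReal_mul (by positivity)]
        congr 1
        ring

/-! ### Lower bound for the sup norm and the integrated inequalities. -/

/-- A bound on the energy bounds the sup norm of a density from below. -/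
theorem exists_one_le_mul_lpNorm_top (d : ℕ) (E : ℝ) :
    ∃ m : ℝ, 0 < m ∧ ∀ g : Vel d → ℝ, IsDensity g → energy g ≤ E → MemLp g ∞ →
      1 ≤ m * lpNorm g ∞ volume := by
  obtain ⟨R, hR, hball⟩ := exists_le_setIntegral_ball d E
  set B := volume.real (Metric.ball (0 : Vel d) R)
  have hB : 0 ≤ B := measureReal_nonneg
  refine ⟨4 / 3 * (B + 1), by positivity, fun g hg hE hg_top => ?_⟩
  have h1 : ∫ w in Metric.ball 0 R, g w ≤ ∫ w in Metric.ball (0 : Vel d) R, lpNorm g ∞ volume := by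
    refine integral_mono_ae hg.integrable.integrableOn
      (integrableOn_const measure_ball_lt_top.ne) (ae_restrict_of_ae ?_)
    filter_upwards [ae_le_lpNorm_exponent_top hg_top] with w hw
    exact (le_abs_self _).trans hw
  rw [setIntegral_const, smul_eq_mul] at h1
  have h2 := hball g hg hE
  have h3 : 0 ≤ lpNorm g ∞ volume := lpNorm_nonneg
  linarith

/-- Allows an integral to be bounded above through a nonnegative majorant whose integrability has
not been established. -/
theorem integral_le_toReal_lintegral {α : Type*} [MeasurableSpace α] {μ : Measure α} {φ : α → ℝ}
    (hφ : Integrable φ μ) : ∫ x, φ x ∂μ ≤ (∫⁻ x, ENNReal.ofReal (φ x) ∂μ).toReal := by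
  rw [integral_eq_lintegral_pos_part_sub_lintegral_neg_part hφ]
  exact sub_le_self _ ENNReal.toReal_nonneg

theorem jb_rpow_neg_neg_three (v : Vel d) : jb v ^ (-(-3 : ℝ)) = jb v ^ 3 := by
  rw [neg_neg, ← Real.rpow_natCast]
  norm_num

theorem jb_nonneg (v : Vel d) : 0 ≤ jb v := Real.sqrt_nonneg _

theorem measurable_jb : Measurable (jb (d := d)) := by
  unfold jb
  fun_prop

/-- The entropy dissipation inequality with explicit convolution errors. -/
theorem exists_integral_lhs_le (d : ℕ) {γ : ℝ} (hγ : γ ≤ 0) (E H : ℝ) :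
    ∃ C : ℝ, 0 < C ∧ ∀ f g : Vel d → ℝ, IsDensity f → IsDensity g → energy g ≤ E →
      entropy g ≤ H → LhsFinite γ f g → RhsFinite γ f g →
        (∫ v, lhsIntegrand γ f g v) ≤
          -(1 / 2) * (∫ v, dissipationIntegrand γ f g v)
            + C * (∫ v, diffusionErrorIntegrand γ f g v)
            + C * (∫ v, driftErrorIntegrand γ f g v) := by
  obtain ⟨C, hC, h⟩ := exists_lhsIntegrand_le d hγ E H
  refine ⟨C, hC, fun f g hf hg hE hH hL hR => ?_⟩
  have h1 := hR.dissipation.const_mul (-(1 / 2))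
  have h2 := hR.diffusionError.const_mul C
  have h3 := hR.driftError.const_mul C
  have := integral_mono_ae hL.integrable ((h1.add h2).add h3)
    (h f g hf hg hE hH hL hR.convA_right hR.convA_sub hR.convB_sub)
  rwa [integral_add' (h1.add h2) h3, integral_add' h1 h2, integral_const_mul, integral_const_mul,
    integral_const_mul] at this

/-- The entropy dissipation inequality for the Coulomb kernel, in terms of the relative entropy. -/
theorem exists_integral_lhs_coulomb_le (E H : ℝ) :
    ∃ C : ℝ, 0 < C ∧ ∀ f g : Vel 3 → ℝ, IsDensity f → IsDensity g → energy g ≤ E →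
      entropy g ≤ H → LhsFinite (-3) f g → CoulombRhsFinite f g →
        (∫ v, lhsIntegrand (-3) f g v) ≤
          -(1 / 2) * (∫ v, dissipationIntegrand (-3) f g v)
            + C * KL f g * coulombFactor f g := by
  obtain ⟨C, hC, h⟩ := exists_lhsIntegrand_le 3 (γ := -3) (by norm_num) E H
  obtain ⟨m, hm, hsup⟩ := exists_one_le_mul_lpNorm_top 3 E
  obtain ⟨k, hk, hkE⟩ := exists_lintegral_truncPowE_le
  refine ⟨C * (16 * k ^ 2 + 16 * k ^ 3 + 32 * m + 32), by positivity,
    fun f g hf hg hE hH hL hR => ?_⟩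
  have hhi : Integrable (f - g) := hf.integrable.sub hg.integrable
  have hht : MemLp (f - g) ∞ := hR.sup_left.sub hR.sup_right
  have hhm : Measurable (f - g) := hf.measurable.sub hg.measurable
  have hpt := h f g hf hg hE hH hL
    (.of_forall fun v _ => convAExistsAt_coulomb hg.integrable hR.sup_right v)
    (.of_forall fun v _ => convAExistsAt_coulomb hhi hht v)
    (.of_forall fun v _ => convBExistsAt_coulomb hhi hht v)
  have hK := (lintegral_sq_sub_div_add_le hf hg hL.pos hR.kl).1
  have hN1 := lintegral_enorm_sub_sq_le hf hg hL.pos hR.kl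
  have hN2 := lintegral_enorm_sub_pow_two_le hf hg hL.pos hR.kl hR.sup_left hR.sup_right
  have hM1 := hsup g hg hE hR.sup_right
  set K := KL f g with hKdef
  have hMf : 0 ≤ lpNorm f ∞ volume := lpNorm_nonneg
  have hMg : 0 ≤ lpNorm g ∞ volume := lpNorm_nonneg
  rw [coulombFactor]
  set M := lpNorm f ∞ volume + lpNorm g ∞ volume with hMdef
  have hM : 0 ≤ M := add_nonneg hMf hMg
  -- Turns the term `32 K` coming from the `L¹` norm into `32 m M K`, which carries the required sup
  -- norm factor.
  have hmM : 1 ≤ m * M := by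
    rw [hMdef, mul_add]
    nlinarith
  set S := lpNorm (fun v => f v * jb v ^ 3 * ‖score f v‖ ^ 2) 1 volume with hSdef
  set P2 := lpNorm (fun v => f v * jb v ^ 3) 2 volume with hP2def
  set P1 := lpNorm (fun v => f v * jb v ^ 3) 1 volume with hP1def
  have hS : 0 ≤ S := lpNorm_nonneg
  have hP2 : 0 ≤ P2 := lpNorm_nonneg
  have hP1 : 0 ≤ P1 := lpNorm_nonneg
  have hF0 : ∀ v, 0 ≤ f v * jb v ^ 3 := fun v =>
    mul_nonneg (hf.nonneg v) (pow_nonneg (jb_nonneg v) 3)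
  have hA : ∀ v, ‖convA (-3) (f - g) v‖ ^ 2 ≤ (16 * k ^ 2 + 32 * m) * M * K := fun v => by
    have h1 := enorm_convA_coulomb_le hhm hkE v
    have h2 : ‖convA (-3) (f - g) v‖ₑ ^ 2 ≤
        8 * (ENNReal.ofReal (2 * M * K) * ENNReal.ofReal k ^ 2 + ENNReal.ofReal (4 * K)) :=
      h1.trans (by gcongr)
    rw [← ofReal_norm, ← ENNReal.ofReal_pow (norm_nonneg _), ← ENNReal.ofReal_pow hk.le,
      ← ENNReal.ofReal_mul (by positivity), ← ENNReal.ofReal_add (by positivity) (by positivity),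
      show (8 : ℝ≥0∞) = ENNReal.ofReal 8 by norm_num, ← ENNReal.ofReal_mul (by norm_num),
      ENNReal.ofReal_le_ofReal_iff (by positivity)] at h2
    refine h2.trans ?_
    nlinarith
  have hdiff : ∫⁻ v, ENNReal.ofReal (C * ((16 * k ^ 2 + 32 * m) * M * K) *
      (f v * jb v ^ 3 * ‖score f v‖ ^ 2)) =
      ENNReal.ofReal (C * ((16 * k ^ 2 + 32 * m) * M * K) * S) := by
    have e : ∫⁻ v, ENNReal.ofReal (f v * jb v ^ 3 * ‖score f v‖ ^ 2) = ENNReal.ofReal S := by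
      rw [hSdef, ofReal_lpNorm hR.fisher, eLpNorm_one_eq_lintegral_enorm]
      refine lintegral_congr fun v => ?_
      rw [Real.enorm_of_nonneg (mul_nonneg (hF0 v) (sq_nonneg _))]
    rw [ENNReal.ofReal_mul (by positivity), ← e, ← lintegral_const_mul' _ _ ENNReal.ofReal_ne_top]
    refine lintegral_congr fun v => ?_
    rw [ENNReal.ofReal_mul (by positivity)]
  have hdrift : ∫⁻ v, ENNReal.ofReal (C * driftErrorIntegrand (-3) f g v) ≤
      ENNReal.ofReal (C * (16 * k ^ 3 * M * K * P2 + 32 * K * P1)) := by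
    have e : ∀ v, ENNReal.ofReal (C * driftErrorIntegrand (-3) f g v) =
        ENNReal.ofReal C * (‖f v * jb v ^ 3‖ₑ * ‖convB (-3) (f - g) v‖ₑ ^ 2) := fun v => by
      rw [ENNReal.ofReal_mul hC.le, driftErrorIntegrand, jb_rpow_neg_neg_three,
        ENNReal.ofReal_mul (hF0 v), Real.enorm_of_nonneg (hF0 v), ← ofReal_norm,
        ENNReal.ofReal_pow (norm_nonneg _)]
    simp only [e]
    rw [lintegral_const_mul' _ _ ENNReal.ofReal_ne_top, ENNReal.ofReal_mul hC.le]
    gcongr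
    refine (lintegral_mul_enorm_convB_coulomb_le hhm hkE
      (F := fun v => f v * jb v ^ 3) (hf.measurable.mul (measurable_jb.pow_const 3))).trans ?_
    rw [← ofReal_lpNorm hR.weighted_two, ← ofReal_lpNorm hR.weighted_one, ← hP2def, ← hP1def]
    calc _ ≤ 8 * (ENNReal.ofReal k ^ 3 * ENNReal.ofReal (2 * M * K) * ENNReal.ofReal P2 +
          ENNReal.ofReal (4 * K) * ENNReal.ofReal P1) := by gcongr
      _ = _ := by
        rw [← ENNReal.ofReal_pow hk.le, ← ENNReal.ofReal_mul (by positivity),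
          ← ENNReal.ofReal_mul (by positivity), ← ENNReal.ofReal_mul (by positivity),
          ← ENNReal.ofReal_add (by positivity) (by positivity),
          show (8 : ℝ≥0∞) = ENNReal.ofReal 8 by norm_num, ← ENNReal.ofReal_mul (by norm_num)]
        congr 1
        ring
  -- With the dissipation on the left, the right-hand side is nonnegative and is integrated in
  -- `ℝ≥0∞`; integrability of the two error integrands is never needed.
  have hφ : Integrable fun v => lhsIntegrand (-3) f g v +
      1 / 2 * dissipationIntegrand (-3) f g v :=
    hL.integrable.add (hR.dissipation.const_mul (1 / 2))
  have hbound : ∫⁻ v, ENNReal.ofReal (lhsIntegrand (-3) f g v +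
      1 / 2 * dissipationIntegrand (-3) f g v) ≤
      ENNReal.ofReal (C * ((16 * k ^ 2 + 32 * m) * M * K) * S +
        C * (16 * k ^ 3 * M * K * P2 + 32 * K * P1)) := by
    rw [ENNReal.ofReal_add (by positivity) (by positivity), ← hdiff]
    refine le_trans ?_ (add_le_add_right hdrift _)
    rw [← lintegral_add_left' ((hR.fisher.aestronglyMeasurable.aemeasurable.const_mul
      _).ennreal_ofReal)]
    refine lintegral_mono_ae ?_
    filter_upwards [hpt] with v hv
    rw [← ENNReal.ofReal_add (mul_nonneg (by positivity) (mul_nonneg (hF0 v) (sq_nonneg _)))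
      (mul_nonneg hC.le (driftErrorIntegrand_nonneg _ hf g v))]
    refine ENNReal.ofReal_le_ofReal ?_
    have h1 : diffusionErrorIntegrand (-3) f g v ≤
        (16 * k ^ 2 + 32 * m) * M * K * (f v * jb v ^ 3 * ‖score f v‖ ^ 2) := by
      rw [diffusionErrorIntegrand, jb_rpow_neg_neg_three]
      have := mul_le_mul_of_nonneg_left (hA v) (mul_nonneg (hF0 v) (sq_nonneg ‖score f v‖))
      linarith
    have h2 := mul_le_mul_of_nonneg_left h1 hC.le
    linarith
  have hfin := (integral_le_toReal_lintegral hφ).trans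
    (ENNReal.toReal_le_of_le_ofReal (by positivity) hbound)
  rw [integral_add hL.integrable (hR.dissipation.const_mul (1 / 2)), integral_const_mul] at hfin
  have hCK : 0 ≤ C * K := by positivity
  have hlast : (16 * k ^ 2 + 32 * m) * M * S + (16 * k ^ 3 * M * P2 + 32 * P1) ≤
      (16 * k ^ 2 + 16 * k ^ 3 + 32 * m + 32) * (M * (S + P2) + P1) := by
    have t1 : 0 ≤ (16 * k ^ 3 + 32) * (M * S) := by positivity
    have t2 : 0 ≤ (16 * k ^ 2 + 32 * m + 32) * (M * P2) := by positivity
    have t3 : 0 ≤ (16 * k ^ 2 + 16 * k ^ 3 + 32 * m) * P1 := by positivity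
    nlinarith
  have := mul_le_mul_of_nonneg_left hlast hCK
  linarith

end Landau

open Landau in
theorem mainTheorem3 :
    (∀ (d : ℕ) (γ : ℝ), γ ≤ 0 → ∀ E H : ℝ, ∃ C : ℝ, 0 < C ∧
      ∀ f g : Vel d → ℝ, IsDensity f → IsDensity g → energy g ≤ E → entropy g ≤ H →
        LhsFinite γ f g → RhsFinite γ f g →
        (∫ v, lhsIntegrand γ f g v) ≤
          -(1 / 2) * (∫ v, dissipationIntegrand γ f g v)
            + C * (∫ v, diffusionErrorIntegrand γ f g v)
            + C * (∫ v, driftErrorIntegrand γ f g v)) ∧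
    (∀ E H : ℝ, ∃ C : ℝ, 0 < C ∧
      ∀ f g : Vel 3 → ℝ, IsDensity f → IsDensity g → energy g ≤ E → entropy g ≤ H →
        LhsFinite (-3) f g → CoulombRhsFinite f g →
        (∫ v, lhsIntegrand (-3) f g v) ≤
          -(1 / 2) * (∫ v, dissipationIntegrand (-3) f g v)
            + C * KL f g * coulombFactor f g) :=
  ⟨fun d _ hγ => exists_integral_lhs_le d hγ, exists_integral_lhs_coulomb_le⟩
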